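/- Let $1\le k\le n$, $\mathrm{St}(n,k)=\{X\in\mathbb R^{n\times k}: X^\top X=I_k\}$, with the metric induced by the scaled Euclidean metric $\langle V,W\rangle=2\operatorname{tr}(V^\top W)$ on $\mathbb R^{n\times k}$. For $X\in \mathrm{St}(n,k)$ write $T_X=T_X\mathrm{St}(n,k)=\{V: X^\top V+V^\top X=0\}$, $N_X=N_X\mathrm{St}(n,k)=T_X^\perp$, $P_X^\perp(V)=\tfrac12X(X^\top V+V^\top X)$ (the orthogonal projection onto $N_X$), and $\Phi_{(R,\theta)}(V)=RV\theta^\top$ for $(R,\theta)\in O(n)\times O(k)$. Equip $\mathfrak g=\mathfrak{so}(n)\times\mathfrak{so}(k)$ with the scalar product $\langle(\Omega_1,\Psi_1),(\Omega_2,\Psi_2)\rangle=-\operatorname{tr}(\Omega_1\Omega_2)+2\operatorname{tr}(\Psi_1\Psi_2)$ (the case $\alpha=-\tfrac12$ of the $\alpha$-metrics). Let $\mathfrak h=\{(\Omega,\eta)\in\mathfrak g:\Omega X-X\eta=0\}$ be the Lie algebra of the stabilizer of $X$ and $\mathfrak p=\mathfrak h^\perp$; then $\mathfrak g=\mathfrak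 p\oplus\mathfrak h$, $\mathrm{pr}_{\mathfrak p}$ denotes the projection onto $\mathfrak p$ along $\mathfrak h$, and $\lambda:\mathfrak p\to T_X$, $\lambda(\Omega,\eta)=\Omega X-X\eta$, is an isomorphism with inverse $V\mapsto(VX^\top-XV^\top,\,X^\top V)$. Let $I\subset\mathbb R$ be an interval, not a single point, with $0\in I$. Curves are smooth ($C^\infty$). An extrinsic rolling of $T_X$ over $\mathrm{St}(n,k)$ is a quadruple $(\beta,\widehat\beta,B,C)$ consisting of curves $\beta:I\to T_X$, $\widehat\beta:I\to\mathrm{St}(n,k)$ and linear isometries $B(t):T_X\to T_{\widehat\beta(t)}\mathrm{St}(n,k)$, $C(t):N_X\to N_{\widehat\beta(t)}\mathrm{St}(n,k)$ (onto), $t\in I$, such that (i) $\dot{\widehat\beta}(t)=B(t)\dot\beta(t)$ for all $t\in I$; (ii) for every $Z:I\to T_X$, $B(t)Z(t)$ is a parallel vector field along $\widehat\beta$ if and only if $Z$ is a parallel vector field along $\beta$; (iii) for every $Z:I\to N_X$, $C(t)Z(t)$ is a normal parallel vector field along $\widehat\beta$ if and only if $Z$ is one along $\beta$. Here a smooth tangent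 (normal) vector field along a curve is parallel (normal parallel) if the orthogonal projection of its derivative onto the tangent (normal) spaces along the curve vanishes. Let $X\in\mathrm{St}(n,k)$ and let $\beta:I\to T_X$ be a curve with control curve $u=\lambda^{-1}\circ\dot\beta:I\to\mathfrak p$. Consider, for curves $S$ in $\mathrm{End}(\mathfrak p)$ and $q=(R,\theta)$ in $\mathbb R^{n\times n}\times\mathbb R^{k\times k}$, the initial value problem $$\text{(1)}\quad \dot S=-\tfrac12\,\mathrm{pr}_{\mathfrak p}\circ\mathrm{ad}_{Su}\circ S,\ S(0)=\mathrm{id}_{\mathfrak p};\qquad \dot q=(R\,\omega_1,\theta\,\omega_2)\ \text{ with }(\omega_1,\omega_2)=Su,\ q(0)=(I_n,I_k),$$ and, for a curve $T$ in $\mathrm{End}(N_X)$, $$\text{(2)}\quad \dot T=-P_X^\perp\circ f_{(\xi_1,\xi_2)}\circ T,\ T(0)=\mathrm{id}_{N_X},\qquad (\xi_1,\xi_2)=(R^\top\dot R,\theta^\top\dot\theta),\quad f_{(\xi_1,\xi_2)}(V)=\xi_1V-V\xi_2 .$$ For $S$ and $q$ put $\widehat\beta(t)=R(t)X\theta(t)^\top$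 and $B(t)=d_{q(t)}\Phi_X\circ d_eL_{q(t)}\circ S(t)\circ\lambda^{-1}$, where $\Phi_X(R,\theta)=RX\theta^\top$ and $L_q$ is left translation by $q$ in $O(n)\times O(k)$; explicitly, $B(t)V=R(t)\big(\lambda(S(t)\lambda^{-1}V)\big)\theta(t)^\top$. (a) The system (1)–(2) has exactly one solution $(S,q,T)$ on $I$. (b) Let $(\beta,\widehat\beta,B)$ be the intrinsic rolling obtained in this way from a solution of (1), let $q=(R,\theta):I\to O(n)\times O(k)$ be the horizontal lift of $\widehat\beta$ through $q(0)=(I_n,I_k)$ (that is, $R X\theta^\top=\widehat\beta$ and $(\xi_1,\xi_2)=(R^\top\dot R,\theta^\top\dot\theta)\in\mathfrak p$ on $I$), and let $T$ be the solution of (2) for this $q$. Then $T(t)\in O(N_X)$ for all $t\in I$, and $(\beta,\widehat\beta,B,C)$ with $C(t)=\Phi_{(R(t),\theta(t))}\circ T(t)$ is an extrinsic rolling of $T_X\mathrm{St}(n,k)$ over $\mathrm{St}(n,k)$. (c) If $(S,q,T)$ solves the full system (1)–(2) of kinematic equations on $I$, then $S(t)\in O(\mathfrak p)$, $q(t)\in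 O(n)\times O(k)$ and $T(t)\in O(N_X)$ for all $t\in I$, and $(\beta,\widehat\beta,B,C)$, with $\widehat\beta$ and $B$ formed from $S$ and $q$ and with $C(t)=\Phi_{(R(t),\theta(t))}\circ T(t)$, is an extrinsic rolling of $T_X\mathrm{St}(n,k)$ over $\mathrm{St}(n,k)$. -/

import Mathlib

open scoped Matrix ContDiff Matrix.Norms.Elementwise

/-- Real matrices with `n` rows and `k` columns. They carry the entrywise sup norm, which is used
only to speak of smooth curves and derivatives (all norms on this space are equivalent). The metric
geometry is that of `euclideanMetric` below. -/
abbrev Mat (n k : ℕ) : Type := Matrix (Fin n) (Fin k) ℝ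

/-- The Lie algebra `so(n) × so(k)` of `O(n) × O(k)`, with its componentwise commutator bracket. -/
abbrev SoPair (n k : ℕ) : Type :=
  LieAlgebra.Orthogonal.so (Fin n) ℝ × LieAlgebra.Orthogonal.so (Fin k) ℝ

section Stiefel

variable {n k : ℕ}

/-! ### The Stiefel manifold as a submanifold of the Euclidean space of `n × k` matrices -/

/-- The Stiefel manifold `St(n,k) = {X | Xᵀ X = 1}`. -/
def stiefel (n k : ℕ) : Set (Mat n k) := {X | Xᵀ * X = 1}

/-- The scaled Euclidean metric `⟨V, W⟩ = 2 tr(Vᵀ W)`. -/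
def euclideanMetric (n k : ℕ) : LinearMap.BilinForm ℝ (Mat n k) :=
  LinearMap.mk₂ ℝ (fun V W => 2 * (Vᵀ * W).trace)
    (fun V V' W => by simp [Matrix.add_mul, mul_add])
    (fun c V W => by simp; ring)
    (fun V W W' => by simp [Matrix.mul_add, mul_add])
    (fun c V W => by simp; ring)

/-- The tangent space `T_X St(n,k) = {V | Xᵀ V + Vᵀ X = 0}`. -/
def tangentSpaceSt (X : Mat n k) : Submodule ℝ (Mat n k) where
  carrier := {V | Xᵀ * V + Vᵀ * X = 0}
  zero_mem' := by simp
  add_mem' := by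
    intro V W hV hW
    simp only [Set.mem_ofPred_eq] at hV hW ⊢
    have : Xᵀ * (V + W) + (V + W)ᵀ * X = (Xᵀ * V + Vᵀ * X) + (Xᵀ * W + Wᵀ * X) := by
      simp only [Matrix.mul_add, Matrix.transpose_add, Matrix.add_mul]; abel
    rw [this, hV, hW, add_zero]
  smul_mem' := by
    intro c V hV
    simp only [Set.mem_ofPred_eq] at hV ⊢
    have : Xᵀ * (c • V) + (c • V)ᵀ * X = c • (Xᵀ * V + Vᵀ * X) := by simp
    rw [this, hV, smul_zero]

theorem mem_tangentSpaceSt {X V : Mat n k} :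
    V ∈ tangentSpaceSt X ↔ Xᵀ * V + Vᵀ * X = 0 := Iff.rfl

/-- The normal space `N_X St(n,k) = (T_X St(n,k))^⊥`. It is also the normal space of the vector
space `T_X St(n,k)` at each of its points. -/
def normalSpaceSt (X : Mat n k) : Submodule ℝ (Mat n k) :=
  (euclideanMetric n k).orthogonal (tangentSpaceSt X)

theorem mem_normalSpaceSt {X V : Mat n k} :
    V ∈ normalSpaceSt X ↔ ∀ W ∈ tangentSpaceSt X, 2 * (Wᵀ * V).trace = 0 := Iff.rfl

theorem mul_mem_normalSpaceSt (X : Mat n k) {A : Mat k k} (hA : Aᵀ = A) :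
    X * A ∈ normalSpaceSt X := by
  rw [mem_normalSpaceSt]
  intro W hW
  rw [mem_tangentSpaceSt] at hW
  have h1 : (Wᵀ * (X * A)).trace = (Xᵀ * W * A).trace := by
    rw [← Matrix.trace_transpose]
    simp only [Matrix.transpose_mul, Matrix.transpose_transpose, hA]
    rw [Matrix.mul_assoc, Matrix.trace_mul_comm]
  have h2 : (Wᵀ * (X * A)).trace + (Xᵀ * W * A).trace = 0 := by
    rw [← Matrix.trace_add, ← Matrix.mul_assoc, ← Matrix.add_mul, add_comm (Wᵀ * X), hW]
    simp
  linarith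

/-- The orthogonal projection `P_X^⊥ V = ½ X (Xᵀ V + Vᵀ X)` onto the normal space
(for `X` in the Stiefel manifold). -/
noncomputable def normalProj (X : Mat n k) : Mat n k →L[ℝ] normalSpaceSt X :=
  LinearMap.toContinuousLinearMap
    { toFun := fun V => ⟨(1 / 2 : ℝ) • (X * (Xᵀ * V + Vᵀ * X)),
        Submodule.smul_mem _ _ (mul_mem_normalSpaceSt X (by
          simp only [Matrix.transpose_add, Matrix.transpose_mul, Matrix.transpose_transpose]
          abel))⟩
      map_add' := by
        intro V W
        ext1
        simp only [Submodule.coe_add, ← smul_add, ← Matrix.mul_add, Matrix.transpose_add,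
          Matrix.add_mul]
        congr 2
        rw [Matrix.mul_add]
        abel
      map_smul' := by
        intro c V
        ext1
        simp only [Submodule.coe_smul, Matrix.mul_smul, Matrix.transpose_smul, Matrix.smul_mul,
          ← smul_add, RingHom.id_apply]
        rw [smul_comm] }

theorem coe_normalProj (X V : Mat n k) :
    (normalProj X V : Mat n k) = (1 / 2 : ℝ) • (X * (Xᵀ * V + Vᵀ * X)) := rfl

/-- `V - P_X^⊥ V` is tangent, so that `normalProj X` is the orthogonal projection. -/
theorem sub_normalProj_mem {X : Mat n k} (hX : X ∈ stiefel n k) (V : Mat n k) :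
    V - (normalProj X V : Mat n k) ∈ tangentSpaceSt X := by
  have hX' : Xᵀ * X = 1 := hX
  rw [mem_tangentSpaceSt, coe_normalProj]
  simp only [Matrix.mul_sub, Matrix.mul_smul, Matrix.transpose_sub, Matrix.transpose_smul,
    Matrix.transpose_mul, Matrix.transpose_add, Matrix.transpose_transpose, Matrix.sub_mul,
    Matrix.smul_mul, ← Matrix.mul_assoc, hX', Matrix.one_mul]
  rw [Matrix.mul_assoc (Vᵀ * X + Xᵀ * V), hX', Matrix.mul_one, add_comm (Vᵀ * X)]
  module

/-! ### The homogeneous space structure -/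

/-- The action `Φ_{(R,θ)} V = R V θᵀ`, for `q = (R, θ)`. -/
def stiefelAction (q : Mat n n × Mat k k) : Mat n k →ₗ[ℝ] Mat n k where
  toFun V := q.1 * V * q.2ᵀ
  map_add' V W := by simp [Matrix.mul_add, Matrix.add_mul]
  map_smul' c V := by simp

/-- The differential at `q` of the orbit map `ι_X ∘ π : (R, θ) ↦ R X θᵀ`. -/
def orbitDifferential (X : Mat n k) (q : Mat n n × Mat k k) :
    Mat n n × Mat k k →ₗ[ℝ] Mat n k where
  toFun v := v.1 * X * q.2ᵀ + q.1 * X * v.2ᵀ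
  map_add' v w := by simp [Matrix.mul_add, Matrix.add_mul]; abel
  map_smul' c v := by simp

/-- `orbitDifferential X q` is indeed the derivative of the orbit map. -/
theorem hasFDerivAt_orbit (X : Mat n k) (q : Mat n n × Mat k k) :
    HasFDerivAt (fun p => stiefelAction p X)
      (LinearMap.toContinuousLinearMap (orbitDifferential X q)) q := by
  let b : Mat n n →ₗ[ℝ] Mat k k →ₗ[ℝ] Mat n k :=
    LinearMap.mk₂ ℝ (fun R θ => R * X * θᵀ)
      (fun R R' θ => by simp [Matrix.add_mul]) (fun c R θ => by simp)
      (fun R θ θ' => by simp [Matrix.mul_add]) (fun c R θ => by simp)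
  have h := (LinearMap.toContinuousBilinearMap b).hasFDerivAt_of_bilinear
    (hasFDerivAt_fst (𝕜 := ℝ) (p := q)) (hasFDerivAt_snd (𝕜 := ℝ) (p := q))
  refine HasFDerivAt.congr_fderiv (f := fun p => stiefelAction p X) h ?_
  refine ContinuousLinearMap.ext fun v => ?_
  change q.1 * X * v.2ᵀ + v.1 * X * q.2ᵀ = v.1 * X * q.2ᵀ + q.1 * X * v.2ᵀ
  abel

/-- The inclusion of `so(n) × so(k)` into pairs of matrices. -/
def soInclusion (n k : ℕ) : SoPair n k →ₗ[ℝ] Mat n n × Mat k k where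
  toFun ξ := ((ξ.1 : Mat n n), (ξ.2 : Mat k k))
  map_add' v w := by simp
  map_smul' c v := by simp

/-- The differential at the identity of left translation by `q = (R, θ)`,
`(Ω, η) ↦ (R Ω, θ η)`. -/
def leftTranslate (q : Mat n n × Mat k k) : SoPair n k →ₗ[ℝ] Mat n n × Mat k k where
  toFun ξ := (q.1 * (ξ.1 : Mat n n), q.2 * (ξ.2 : Mat k k))
  map_add' v w := by simp [Matrix.mul_add]
  map_smul' c v := by simp

/-- The scalar product `-tr(Ω₁ Ω₂) - α⁻¹ tr(Ψ₁ Ψ₂)` on `so(n) × so(k)`. -/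
noncomputable def alphaForm (n k : ℕ) (α : ℝ) : LinearMap.BilinForm ℝ (SoPair n k) :=
  LinearMap.mk₂ ℝ
    (fun ξ ζ => -((ξ.1 : Mat n n) * (ζ.1 : Mat n n)).trace
      - 1 / α * ((ξ.2 : Mat k k) * (ζ.2 : Mat k k)).trace)
    (fun ξ₁ ξ₂ ζ => by simp [Matrix.add_mul]; ring)
    (fun c ξ ζ => by simp; ring)
    (fun ξ ζ₁ ζ₂ => by simp [Matrix.mul_add]; ring)
    (fun c ξ ζ => by simp; ring)

theorem alphaForm_apply (α : ℝ) (ξ ζ : SoPair n k) :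
    alphaForm n k α ξ ζ = -((ξ.1 : Mat n n) * (ζ.1 : Mat n n)).trace
      - 1 / α * ((ξ.2 : Mat k k) * (ζ.2 : Mat k k)).trace := rfl

/-- The differential `(Ω, η) ↦ Ω X - X η` of the orbit map at the identity, on `so(n) × so(k)`. -/
def infAction (X : Mat n k) : SoPair n k →ₗ[ℝ] Mat n k where
  toFun ξ := (ξ.1 : Mat n n) * X - X * (ξ.2 : Mat k k)
  map_add' v w := by simp [Matrix.add_mul, Matrix.mul_add]; abel
  map_smul' c v := by simp [smul_sub]

theorem infAction_apply (X : Mat n k) (ξ : SoPair n k) :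
    infAction X ξ = (ξ.1 : Mat n n) * X - X * (ξ.2 : Mat k k) := rfl

/-- The Lie algebra `𝔥 = {(Ω, η) | Ω X - X η = 0}` of the stabilizer of `X` in `O(n) × O(k)`. -/
def stabAlgebra (X : Mat n k) : Submodule ℝ (SoPair n k) := LinearMap.ker (infAction X)

theorem mem_stabAlgebra {X : Mat n k} {ξ : SoPair n k} :
    ξ ∈ stabAlgebra X ↔ (ξ.1 : Mat n n) * X - X * (ξ.2 : Mat k k) = 0 := Iff.rfl

/-- The space `𝔭 = 𝔥^⊥`, the orthogonal complement being taken with respect to the scalar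
product with parameter `α = -1/2`. -/
noncomputable def horizontalAlgebra (X : Mat n k) : Submodule ℝ (SoPair n k) :=
  (alphaForm n k (-1 / 2)).orthogonal (stabAlgebra X)

theorem mem_horizontalAlgebra {X : Mat n k} {ξ : SoPair n k} :
    ξ ∈ horizontalAlgebra X ↔ ∀ ζ ∈ stabAlgebra X, alphaForm n k (-1 / 2) ζ ξ = 0 := Iff.rfl

theorem so_transpose {m : ℕ} (A : LieAlgebra.Orthogonal.so (Fin m) ℝ) :
    (A : Mat m m)ᵀ = -(A : Mat m m) :=
  (LieAlgebra.Orthogonal.mem_so _ _ _).1 A.2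

theorem infAction_mem_tangentSpaceSt {X : Mat n k} (hX : X ∈ stiefel n k) (ξ : SoPair n k) :
    infAction X ξ ∈ tangentSpaceSt X := by
  have hX' : Xᵀ * X = 1 := hX
  rw [mem_tangentSpaceSt, infAction_apply]
  simp only [Matrix.mul_sub, Matrix.transpose_sub, Matrix.transpose_mul, so_transpose,
    Matrix.sub_mul, Matrix.mul_neg, Matrix.neg_mul, ← Matrix.mul_assoc, hX', Matrix.one_mul]
  rw [Matrix.mul_assoc _ Xᵀ X, hX', Matrix.mul_one]
  abel

/-- The element `(V Xᵀ - X Vᵀ, Xᵀ V)` of `so(n) × so(k)`, for `V` tangent at `X`. -/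
def tangentToSo (X : Mat n k) (V : tangentSpaceSt X) : SoPair n k :=
  (⟨(V : Mat n k) * Xᵀ - X * (V : Mat n k)ᵀ, by
      rw [LieAlgebra.Orthogonal.mem_so]; simp⟩,
   ⟨Xᵀ * (V : Mat n k), by
      rw [LieAlgebra.Orthogonal.mem_so, eq_neg_iff_add_eq_zero, add_comm]
      simpa using mem_tangentSpaceSt.1 V.2⟩)

theorem tangentToSo_mem (X : Mat n k) (V : tangentSpaceSt X) :
    tangentToSo X V ∈ horizontalAlgebra X := by
  rw [mem_horizontalAlgebra]
  intro ζ hζ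
  rw [mem_stabAlgebra, sub_eq_zero] at hζ
  obtain ⟨V, hV⟩ := V
  rw [alphaForm_apply]
  simp only [tangentToSo]
  have e1 : ((ζ.1 : Mat n n) * (V * Xᵀ)).trace = ((ζ.2 : Mat k k) * (Xᵀ * V)).trace := by
    have h : Xᵀ * (ζ.1 : Mat n n) = (ζ.2 : Mat k k) * Xᵀ := by
      have := congrArg Matrix.transpose hζ
      simpa [so_transpose] using this
    rw [← Matrix.mul_assoc, Matrix.trace_mul_comm, ← Matrix.mul_assoc, h, Matrix.mul_assoc]
  have e2 : ((ζ.1 : Mat n n) * (X * Vᵀ)).trace = -((ζ.2 : Mat k k) * (Xᵀ * V)).trace := by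
    rw [← Matrix.mul_assoc, hζ, Matrix.mul_assoc, Matrix.trace_mul_comm, ← Matrix.trace_transpose]
    simp only [Matrix.transpose_mul, Matrix.transpose_transpose, so_transpose,
      Matrix.mul_assoc]
    rw [← Matrix.mul_assoc, Matrix.mul_neg, Matrix.trace_neg, Matrix.trace_mul_comm]
  rw [Matrix.mul_sub, Matrix.trace_sub, e1, e2]
  ring

theorem infAction_tangentToSo {X : Mat n k} (hX : X ∈ stiefel n k) (V : tangentSpaceSt X) :
    infAction X (tangentToSo X V) = V := by
  have hX' : Xᵀ * X = 1 := hX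
  obtain ⟨V, hV⟩ := V
  rw [mem_tangentSpaceSt] at hV
  rw [infAction_apply]
  simp only [tangentToSo]
  rw [Matrix.sub_mul, Matrix.mul_assoc V, hX', Matrix.mul_one, Matrix.mul_assoc X, sub_sub,
    ← Matrix.mul_add, add_comm (Vᵀ * X), hV]
  simp

theorem so_eq_zero_of_trace {m : ℕ} (A : LieAlgebra.Orthogonal.so (Fin m) ℝ)
    (h : ((A : Mat m m) * (A : Mat m m)).trace = 0) : A = 0 := by
  have h' : ((A : Mat m m)ᵀ * (A : Mat m m)).trace = 0 := by
    rw [so_transpose, Matrix.neg_mul, Matrix.trace_neg, h, neg_zero]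
  ext1
  exact (Matrix.trace_conjTranspose_mul_self_eq_zero_iff (A := (A : Mat m m))).1
    (by rwa [Matrix.conjTranspose_eq_transpose_of_trivial])

theorem sub_tangentToSo_mem {X : Mat n k} (hX : X ∈ stiefel n k) (ξ : SoPair n k) :
    ξ - tangentToSo X ⟨infAction X ξ, infAction_mem_tangentSpaceSt hX ξ⟩ ∈ stabAlgebra X := by
  rw [stabAlgebra, LinearMap.mem_ker, map_sub, infAction_tangentToSo hX, sub_self]

theorem alphaForm_comm (α : ℝ) (ξ ζ : SoPair n k) :
    alphaForm n k α ξ ζ = alphaForm n k α ζ ξ := by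
  rw [alphaForm_apply, alphaForm_apply, Matrix.trace_mul_comm,
    Matrix.trace_mul_comm (ξ.2 : Mat k k)]

theorem disjoint_horizontal_stab {X : Mat n k} (hX : X ∈ stiefel n k) :
    Disjoint (horizontalAlgebra X) (stabAlgebra X) := by
  rw [Submodule.disjoint_def]
  intro ξ hp hs
  have key : ∀ ζ, alphaForm n k (-1 / 2) ζ ξ = 0 := by
    intro ζ
    have h1 := mem_horizontalAlgebra.1 hp _ (sub_tangentToSo_mem hX ζ)
    have h2 := mem_horizontalAlgebra.1
      (tangentToSo_mem X ⟨infAction X ζ, infAction_mem_tangentSpaceSt hX ζ⟩) ξ hs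
    rw [alphaForm_comm] at h2
    rwa [map_sub, LinearMap.sub_apply, h2, sub_zero] at h1
  have k1 := key (ξ.1, 0)
  have k2 := key (0, ξ.2)
  rw [alphaForm_apply] at k1 k2
  ext1
  · exact so_eq_zero_of_trace _ (by simpa using k1)
  · exact so_eq_zero_of_trace _ (by simpa using k2)

/-- The linear isomorphism `(Ω, η) ↦ Ω X - X η` from `𝔭` to `T_X St(n,k)`, with inverse
`V ↦ (V Xᵀ - X Vᵀ, Xᵀ V)`. -/
noncomputable def horizontalEquiv {X : Mat n k} (hX : X ∈ stiefel n k) :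
    horizontalAlgebra X ≃ₗ[ℝ] tangentSpaceSt X where
  toFun ξ := ⟨infAction X (ξ : SoPair n k), infAction_mem_tangentSpaceSt hX _⟩
  map_add' ξ ζ := by ext1; simp
  map_smul' c ξ := by ext1; simp
  invFun V := ⟨tangentToSo X V, tangentToSo_mem X V⟩
  left_inv := by
    intro ξ
    have h1 := sub_tangentToSo_mem hX (ξ : SoPair n k)
    have h2 := Submodule.sub_mem _ ξ.2
      (tangentToSo_mem X ⟨infAction X ξ, infAction_mem_tangentSpaceSt hX ξ⟩)
    have := (Submodule.disjoint_def.1 (disjoint_horizontal_stab hX)) _ h2 h1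
    ext1
    exact (sub_eq_zero.1 this).symm
  right_inv := by
    intro V
    ext1
    exact infAction_tangentToSo hX V

theorem isCompl_horizontal_stab {X : Mat n k} (hX : X ∈ stiefel n k) :
    IsCompl (horizontalAlgebra X) (stabAlgebra X) := by
  refine ⟨disjoint_horizontal_stab hX, ?_⟩
  rw [codisjoint_iff, Submodule.eq_top_iff']
  intro ξ
  rw [Submodule.mem_sup]
  exact ⟨_, tangentToSo_mem X ⟨infAction X ξ, infAction_mem_tangentSpaceSt hX ξ⟩, _,
    sub_tangentToSo_mem hX ξ, by abel⟩

/-- The projection `pr_𝔭` of `so(n) × so(k)` onto `𝔭` along `𝔥`. -/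
noncomputable def projHorizontal {X : Mat n k} (hX : X ∈ stiefel n k) :
    SoPair n k →ₗ[ℝ] horizontalAlgebra X :=
  (horizontalAlgebra X).projectionOnto (stabAlgebra X) (isCompl_horizontal_stab hX)

/-! ### Parallel vector fields and rolling -/

/-- `W` is the orthogonal projection of `V` onto the subspace `F`. -/
def IsOrthogonalProjection (F : Submodule ℝ (Mat n k)) (V W : Mat n k) : Prop :=
  W ∈ F ∧ V - W ∈ (euclideanMetric n k).orthogonal F

/-- The curve `Z` is a smooth section, along the curve `c`, of the subbundle with fibres `F (c t)` of
the trivial bundle of `n × k` matrices, and it is parallel: its covariant derivative, i.e. the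
orthogonal projection of `dZ/dt` onto the fibre, vanishes. For the tangent spaces of a submanifold
this is parallelism for the Levi-Civita connection of the induced metric; for the normal spaces it
is normal parallelism. -/
def IsParallelAlong (I : Set ℝ) (F : Mat n k → Submodule ℝ (Mat n k)) (c Z : ℝ → Mat n k) : Prop :=
  ContDiffOn ℝ ∞ Z I ∧ (∀ t ∈ I, Z t ∈ F (c t)) ∧
    ∀ t ∈ I, IsOrthogonalProjection (F (c t)) (derivWithin Z I t) 0

/-- The linear map `A` from the subspace `F` is an isometry onto the subspace `F'`. -/
def IsIsometryOnto (F F' : Submodule ℝ (Mat n k)) (A : F →ₗ[ℝ] Mat n k) : Prop :=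
  LinearMap.range A = F' ∧
    ∀ V W : F, euclideanMetric n k (A V) (A W) = euclideanMetric n k (V : Mat n k) (W : Mat n k)

/-- Extrinsic rolling of `T_X St(n,k)` over `St(n,k)`, both isometrically embedded into the space of
`n × k` matrices: `β` is the rolling curve, `γ` the development curve, and `B t`, `C t` are the
isometries of the tangent and of the normal spaces. The tangent space of the vector space
`T_X St(n,k)` at each of its points is identified with that space itself. -/
structure IsExtrinsicRolling (X : Mat n k) (I : Set ℝ) (β : ℝ → tangentSpaceSt X)
    (γ : ℝ → Mat n k) (B : ℝ → tangentSpaceSt X →ₗ[ℝ] Mat n k)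
    (C : ℝ → normalSpaceSt X →ₗ[ℝ] Mat n k) : Prop where
  smooth_rolling : ContDiffOn ℝ ∞ β I
  smooth_development : ContDiffOn ℝ ∞ γ I
  development_mem : ∀ t ∈ I, γ t ∈ stiefel n k
  tangent_isometry : ∀ t ∈ I, IsIsometryOnto (tangentSpaceSt X) (tangentSpaceSt (γ t)) (B t)
  normal_isometry : ∀ t ∈ I, IsIsometryOnto (normalSpaceSt X) (normalSpaceSt (γ t)) (C t)
  no_slip : ∀ t ∈ I, derivWithin γ I t = B t (derivWithin β I t)
  no_twist_tangent : ∀ Z : ℝ → tangentSpaceSt X,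
    IsParallelAlong I tangentSpaceSt γ (fun t => B t (Z t)) ↔
      IsParallelAlong I (fun _ => tangentSpaceSt X) (fun t => β t) (fun t => Z t)
  no_twist_normal : ∀ Z : ℝ → normalSpaceSt X,
    IsParallelAlong I normalSpaceSt γ (fun t => C t (Z t)) ↔
      IsParallelAlong I (fun _ => normalSpaceSt X) (fun t => β t) (fun t => Z t)

/-! ### The kinematic equations

Curves of linear maps `S t` and `T t` on finite-dimensional spaces are smooth, and are
differentiated, pointwise; elements of `𝔭` are differentiated as pairs of matrices. -/

/-- The control curve `u(t) ∈ 𝔭`, the image of `dβ/dt` under `T_X St(n,k) ≅ 𝔭`. -/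
noncomputable def controlCurve {X : Mat n k} (hX : X ∈ stiefel n k) (I : Set ℝ)
    (β : ℝ → tangentSpaceSt X) (t : ℝ) : horizontalAlgebra X :=
  (horizontalEquiv hX).symm (derivWithin β I t)

/-- The intrinsic kinematic equations
`dS/dt = -½ pr_𝔭 ∘ ad_{S u} ∘ S`, `S(0) = id` and `dq/dt = (dL_q) (S u)`, `q(0) = (1, 1)`. -/
structure IsIntrinsicKinematicSolution {X : Mat n k} (hX : X ∈ stiefel n k) (I : Set ℝ)
    (β : ℝ → tangentSpaceSt X) (S : ℝ → horizontalAlgebra X →ₗ[ℝ] horizontalAlgebra X)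
    (q : ℝ → Mat n n × Mat k k) : Prop where
  smooth_S : ∀ Z, ContDiffOn ℝ ∞ (fun t => soInclusion n k (S t Z)) I
  smooth_q : ContDiffOn ℝ ∞ q I
  ode_S : ∀ t ∈ I, ∀ Z, derivWithin (fun s => soInclusion n k (S s Z)) I t =
    soInclusion n k (-(1 / 2 : ℝ) • projHorizontal hX
      ⁅(S t (controlCurve hX I β t) : SoPair n k), (S t Z : SoPair n k)⁆)
  ode_q : ∀ t ∈ I, derivWithin q I t = leftTranslate (q t) (S t (controlCurve hX I β t) : SoPair n k)
  init_S : S 0 = LinearMap.id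
  init_q : q 0 = (1, 1)

/-- The development curve `(ι_X ∘ π)(q(t)) = R(t) X θ(t)ᵀ`. -/
def development (X : Mat n k) (q : ℝ → Mat n n × Mat k k) (t : ℝ) : Mat n k :=
  stiefelAction (q t) X

/-- `B(t) = d_{q(t)}(ι_X ∘ π) ∘ dL_{q(t)} ∘ S(t) ∘ (d(ι_X ∘ π)|_𝔭)⁻¹`. -/
noncomputable def tangentRolling {X : Mat n k} (hX : X ∈ stiefel n k)
    (S : ℝ → horizontalAlgebra X →ₗ[ℝ] horizontalAlgebra X) (q : ℝ → Mat n n × Mat k k) (t : ℝ) :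
    tangentSpaceSt X →ₗ[ℝ] Mat n k :=
  orbitDifferential X (q t) ∘ₗ leftTranslate (q t) ∘ₗ (horizontalAlgebra X).subtype ∘ₗ S t ∘ₗ
    (horizontalEquiv hX).symm.toLinearMap

/-- The pair `q = (R, θ)` lies in `O(n) × O(k)`. -/
def IsOrthogonalPair (q : Mat n n × Mat k k) : Prop :=
  q.1 ∈ Matrix.orthogonalGroup (Fin n) ℝ ∧ q.2 ∈ Matrix.orthogonalGroup (Fin k) ℝ

/-- The body velocity `(ξ₁, ξ₂) = (Rᵀ dR/dt, θᵀ dθ/dt)` of a curve `q = (R, θ)`. -/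
noncomputable def bodyVelocity (I : Set ℝ) (q : ℝ → Mat n n × Mat k k) (t : ℝ) :
    Mat n n × Mat k k :=
  ((q t).1ᵀ * (derivWithin q I t).1, (q t).2ᵀ * (derivWithin q I t).2)

/-- The smooth curve `q` in `O(n) × O(k)` is a horizontal lift of the curve `γ` in `St(n,k)`:
it projects to `γ` and its body velocity lies in `𝔭`. -/
structure IsHorizontalLift (X : Mat n k) (I : Set ℝ) (γ : ℝ → Mat n k)
    (q : ℝ → Mat n n × Mat k k) : Prop where
  smooth : ContDiffOn ℝ ∞ q I
  orthogonal : ∀ t ∈ I, IsOrthogonalPair (q t)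
  lifts : ∀ t ∈ I, stiefelAction (q t) X = γ t
  horizontal : ∀ t ∈ I, ∃ ξ ∈ horizontalAlgebra X, bodyVelocity I q t = soInclusion n k ξ

/-- The map `f_{(ξ₁, ξ₂)} V = ξ₁ V - V ξ₂`. -/
def fMap (ξ : Mat n n × Mat k k) (V : Mat n k) : Mat n k := ξ.1 * V - V * ξ.2

/-- The initial value problem `dT/dt = -P_X^⊥ ∘ f_{ξ(t)} ∘ T`, `T(0) = id`, for a curve of
endomorphisms `T` of `N_X St(n,k)`, where `ξ` is the body velocity of `q`. -/
structure IsNormalKinematicSolution (X : Mat n k) (I : Set ℝ) (q : ℝ → Mat n n × Mat k k)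
    (T : ℝ → normalSpaceSt X →ₗ[ℝ] normalSpaceSt X) : Prop where
  smooth_T : ∀ Z, ContDiffOn ℝ ∞ (fun t => T t Z) I
  ode_T : ∀ t ∈ I, ∀ Z, derivWithin (fun s => T s Z) I t =
    -normalProj X (fMap (bodyVelocity I q t) (T t Z : Mat n k))
  init_T : T 0 = LinearMap.id

/-- `C(t) = Φ_{(R(t), θ(t))} ∘ T(t)`. -/
def normalRolling {X : Mat n k} (q : ℝ → Mat n n × Mat k k)
    (T : ℝ → normalSpaceSt X →ₗ[ℝ] normalSpaceSt X) (t : ℝ) : normalSpaceSt X →ₗ[ℝ] Mat n k :=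
  stiefelAction (q t) ∘ₗ (normalSpaceSt X).subtype ∘ₗ T t

/-- The full system of kinematic equations for the extrinsic rolling. -/
def IsExtrinsicKinematicSolution {X : Mat n k} (hX : X ∈ stiefel n k) (I : Set ℝ)
    (β : ℝ → tangentSpaceSt X) (S : ℝ → horizontalAlgebra X →ₗ[ℝ] horizontalAlgebra X)
    (q : ℝ → Mat n n × Mat k k) (T : ℝ → normalSpaceSt X →ₗ[ℝ] normalSpaceSt X) : Prop :=
  IsIntrinsicKinematicSolution hX I β S q ∧ IsNormalKinematicSolution X I q T

/-- `S ∈ O(𝔭)`, for the scalar product with parameter `α = -1/2`. -/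
def IsOrthogonalOnHorizontal {X : Mat n k}
    (S : horizontalAlgebra X →ₗ[ℝ] horizontalAlgebra X) : Prop :=
  Function.Bijective S ∧ ∀ Z W : horizontalAlgebra X,
    alphaForm n k (-1 / 2) (S Z : SoPair n k) (S W : SoPair n k) =
      alphaForm n k (-1 / 2) (Z : SoPair n k) (W : SoPair n k)

/-- `T ∈ O(N_X St(n,k))`, for the Euclidean metric. -/
def IsOrthogonalOnNormal {X : Mat n k} (T : normalSpaceSt X →ₗ[ℝ] normalSpaceSt X) : Prop :=
  Function.Bijective T ∧ ∀ Z W : normalSpaceSt X,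
    euclideanMetric n k (T Z : Mat n k) (T W : Mat n k) =
      euclideanMetric n k (Z : Mat n k) (W : Mat n k)

end Stiefel

/-!
The kinematic equations are equations of parallel transport, written in the moving frame `q`.

Let `F` be `T_X` or `N_X`, let `q` be a smooth curve in `O(n) × O(k)` with body velocity `ξ`, and
consider the bundle with fibres `Φ_q F` along `γ = Φ_q X`, which is the tangent or the normal bundle
of `St(n,k)`. A section `Φ_q A Z` with `A` in `End(F)` has the derivative
`Φ_q (f_ξ A Z + A' Z + A Z')`. If `A' = -P_F ∘ f_ξ ∘ A` (`IsProjectedTransport`), then the first two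
terms add up to a vector orthogonal to `F`, so the section is parallel if and only if `A Z' = 0`.
Since `f_ξ` is skew-adjoint, such an `A` is moreover an isometry, and `A Z' = 0` means that `Z` is
constant (`IsProjectedTransport.preserves`, `IsProjectedTransport.isParallelAlong_iff`). This gives
the isometry and no-twist conditions for the tangent and the normal part at the same time.

For the normal part the equation for `T` has this form by definition. For the tangent part, `S` is
carried to `T_X` by the isomorphism `λ : 𝔭 → T_X`. With `ξ = λ⁻¹ V` and `ζ = λ⁻¹ W` one has
`f_ξ W - f_ζ V = λ(pr_𝔭 [ξ, ζ])`, while `f_ξ W + f_ζ V = -X (Vᵀ W + Wᵀ V)` is normal. Hence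
`½ λ(pr_𝔭 [ξ, ζ])` is the tangential part of `f_ξ W` (`fMap_bodyMap_sub_halfBracket_mem`), and the
equation for `S` becomes the equation of projected transport. The no-slip condition is the equation
for `q`. Only the orthogonality of the lift `q` enters, not its horizontality
(`isExtrinsicRolling_of_lift`).

The system is nonlinear, so its global solvability needs an argument. Multiplying the right-hand side
by a scalar function `c` replaces `ξ` by `c ξ`, which is still skew; therefore the solutions of all
these modified systems stay in the compact set of triples of isometries
(`IsKinematicTransport.norm_le`). In particular this holds for the system multiplied by a cutoff
function which equals one near that compact set. The cut-off field is bounded, hence has solutions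
on every compact interval, and these also solve the original system; uniqueness glues them to a
solution on `I` (`exists_hasDerivWithinAt_of_apriori_bound`).
-/

/-! ### Ordinary differential equations on intervals -/

section ODE

open Set Metric

variable {E U : Type*} [NormedAddCommGroup E] [NormedSpace ℝ E] [FiniteDimensional ℝ E]
  [NormedAddCommGroup U] [NormedSpace ℝ U] [FiniteDimensional ℝ U]

theorem Set.OrdConnected.uniqueDiffOn_real {I : Set ℝ} (hI : I.OrdConnected) (hI' : I.Nontrivial) :
    UniqueDiffOn ℝ I := by
  refine uniqueDiffOn_convex hI.convex ?_
  obtain ⟨a, ha, b, hb, hab⟩ := hI'.exists_lt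
  exact ⟨(a + b) / 2, interior_mono (hI.out ha hb)
    (by rw [interior_Icc]; constructor <;> linarith)⟩

/-- Solutions of `y' = G(u, y)` with the same initial value agree; nothing is assumed about growth,
since two given solutions are bounded on compact intervals. -/
theorem eqOn_of_hasDerivWithinAt {G : U × E → E} (hG : ContDiff ℝ ∞ G) {J : Set ℝ}
    (hJ : J.OrdConnected) (h0 : (0 : ℝ) ∈ J) {u : ℝ → U} (hu : ContinuousOn u J) {y z : ℝ → E}
    (hyz : y 0 = z 0) (hy : ∀ t ∈ J, HasDerivWithinAt y (G (u t, y t)) J t)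
    (hz : ∀ t ∈ J, HasDerivWithinAt z (G (u t, z t)) J t) : EqOn y z J := by
  have key : ∀ a ∈ J, ∀ b ∈ J, ∃ K : NNReal, ∃ ρ : ℝ, ∀ t ∈ Icc a b,
      LipschitzOnWith K (fun x => G (u t, x)) (closedBall 0 ρ) ∧
      y t ∈ closedBall 0 ρ ∧ z t ∈ closedBall 0 ρ := by
    intro a ha b hb
    have hs : Icc a b ⊆ J := hJ.out ha hb
    have bd : ∀ {F : Type _} [NormedAddCommGroup F] (f : ℝ → F), ContinuousOn f J →
        ∃ C, ∀ t ∈ Icc a b, ‖f t‖ ≤ C := fun f hf =>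
      isCompact_Icc.exists_bound_of_continuousOn (hf.mono hs)
    obtain ⟨C₁, h₁⟩ := bd y fun t ht => (hy t ht).continuousWithinAt
    obtain ⟨C₂, h₂⟩ := bd z fun t ht => (hz t ht).continuousWithinAt
    obtain ⟨M, hM⟩ := isCompact_Icc.exists_bound_of_continuousOn (hu.mono hs)
    obtain ⟨K, hK⟩ := hG.contDiffOn.exists_lipschitzOnWith (by simp)
      ((convex_closedBall (0 : U) M).prod (convex_closedBall (0 : E) (max C₁ C₂)))
      ((isCompact_closedBall _ _).prod (isCompact_closedBall _ _))
    refine ⟨K, max C₁ C₂, fun t ht => ⟨?_, ?_, ?_⟩⟩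
    · intro p hp q hq
      have := hK (x := (u t, p)) ⟨by simpa using hM t ht, hp⟩ (y := (u t, q))
        ⟨by simpa using hM t ht, hq⟩
      simpa [Prod.edist_eq] using this
    · simpa using Or.inl (h₁ t ht)
    · simpa using Or.inr (h₂ t ht)
  intro t ht
  rcases le_total 0 t with h | h
  · obtain ⟨K, ρ, hK⟩ := key 0 h0 t ht
    have hs : Icc 0 t ⊆ J := hJ.out h0 ht
    have right : ∀ x : ℝ → E, (∀ t ∈ J, HasDerivWithinAt x (G (u t, x t)) J t) →
        ∀ s ∈ Ico 0 t, HasDerivWithinAt x (G (u s, x s)) (Ici s) s := fun x hx s hs' =>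
      ((hx s (hs (Ico_subset_Icc_self hs'))).mono hs).mono_of_mem_nhdsWithin
        (Filter.mem_of_superset (Icc_mem_nhdsGE hs'.2) (Icc_subset_Icc_left hs'.1))
    exact ODE_solution_unique_of_mem_Icc_right (v := fun t x => G (u t, x))
      (s := fun _ => closedBall 0 ρ) (fun s hs' => (hK s (Ico_subset_Icc_self hs')).1)
      (fun s hs' => ((hy s (hs hs')).mono hs).continuousWithinAt) (right y hy)
      (fun s hs' => (hK s (Ico_subset_Icc_self hs')).2.1)
      (fun s hs' => ((hz s (hs hs')).mono hs).continuousWithinAt) (right z hz)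
      (fun s hs' => (hK s (Ico_subset_Icc_self hs')).2.2) hyz ⟨h, le_rfl⟩
  · obtain ⟨K, ρ, hK⟩ := key t ht 0 h0
    have hs : Icc t 0 ⊆ J := hJ.out ht h0
    have left : ∀ x : ℝ → E, (∀ t ∈ J, HasDerivWithinAt x (G (u t, x t)) J t) →
        ∀ s ∈ Ioc t 0, HasDerivWithinAt x (G (u s, x s)) (Iic s) s := fun x hx s hs' =>
      ((hx s (hs (Ioc_subset_Icc_self hs'))).mono hs).mono_of_mem_nhdsWithin
        (Filter.mem_of_superset (Icc_mem_nhdsLE hs'.1) (Icc_subset_Icc_right hs'.2))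
    exact ODE_solution_unique_of_mem_Icc_left (v := fun t x => G (u t, x))
      (s := fun _ => closedBall 0 ρ) (fun s hs' => (hK s (Ioc_subset_Icc_self hs')).1)
      (fun s hs' => ((hy s (hs hs')).mono hs).continuousWithinAt) (left y hy)
      (fun s hs' => (hK s (Ioc_subset_Icc_self hs')).2.1)
      (fun s hs' => ((hz s (hs hs')).mono hs).continuousWithinAt) (left z hz)
      (fun s hs' => (hK s (Ioc_subset_Icc_self hs')).2.2) hyz ⟨le_rfl, h⟩

/-- A smooth field which is bounded in the state has solutions on all of a compact interval: the
radius of the ball in the Picard–Lindelöf theorem can be taken as large as the time requires. -/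
theorem exists_hasDerivWithinAt_Icc_of_bounded {G : U × E → E} (hG : ContDiff ℝ ∞ G)
    (hb : ∀ M, ∃ L, ∀ v : U, ‖v‖ ≤ M → ∀ x, ‖G (v, x)‖ ≤ L) {a b : ℝ} (ha : a ≤ 0) (hb0 : 0 ≤ b)
    {u : ℝ → U} (hu : ContinuousOn u (Icc a b)) (y₀ : E) :
    ∃ y : ℝ → E, y 0 = y₀ ∧ ∀ t ∈ Icc a b, HasDerivWithinAt y (G (u t, y t)) (Icc a b) t := by
  obtain ⟨M, hM⟩ := isCompact_Icc.exists_bound_of_continuousOn hu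
  obtain ⟨L, hL⟩ := hb M
  let r : NNReal := L.toNNReal * (max (b - 0) (0 - a)).toNNReal
  obtain ⟨K, hK⟩ := hG.contDiffOn.exists_lipschitzOnWith (by simp)
    ((convex_closedBall (0 : U) M).prod (convex_closedBall y₀ r))
    ((isCompact_closedBall _ _).prod (isCompact_closedBall _ _))
  have pl : IsPicardLindelof (fun t x => G (u t, x)) (tmin := a) (tmax := b) ⟨0, ha, hb0⟩ y₀
      r 0 L.toNNReal K := by
    refine ⟨fun t ht p hp q hq => ?_, fun x _ => ?_, fun t ht x _ => ?_, ?_⟩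
    · have := hK (x := (u t, p)) ⟨by simpa using hM t ht, hp⟩ (y := (u t, q))
        ⟨by simpa using hM t ht, hq⟩
      simpa [Prod.edist_eq] using this
    · exact hG.continuous.comp_continuousOn (hu.prodMk continuousOn_const)
    · exact (hL _ (hM t ht) x).trans (Real.le_coe_toNNReal L)
    · simp only [r, NNReal.coe_mul, NNReal.coe_zero, sub_zero]
      gcongr
      exact Real.le_coe_toNNReal _
  exact pl.exists_eq_forall_mem_Icc_hasDerivWithinAt₀

/-- Each point of an interval containing `0` has a neighbourhood in the interval of the form
`[a, b]` with `a ≤ 0 ≤ b`. -/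
theorem exists_Icc_mem_nhdsWithin {I : Set ℝ} (h0 : (0 : ℝ) ∈ I)
    {t : ℝ} (ht : t ∈ I) :
    ∃ a ∈ I, ∃ b ∈ I, a ≤ 0 ∧ 0 ≤ b ∧ Icc a b ∈ nhdsWithin t I := by
  have hr : ∃ b ∈ I, 0 ≤ b ∧ Iic b ∈ nhdsWithin t I := by
    by_cases h : ∃ b ∈ I, t < b
    · obtain ⟨b, hb, htb⟩ := h
      refine ⟨max b 0, by rcases max_choice b 0 with h | h <;> rwa [h], le_max_right _ _,
        mem_nhdsWithin_of_mem_nhds (Iic_mem_nhds (lt_max_of_lt_left htb))⟩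
    · push Not at h
      exact ⟨t, ht, h 0 h0, Filter.mem_of_superset self_mem_nhdsWithin h⟩
  have hl : ∃ a ∈ I, a ≤ 0 ∧ Ici a ∈ nhdsWithin t I := by
    by_cases h : ∃ a ∈ I, a < t
    · obtain ⟨a, ha, hat⟩ := h
      refine ⟨min a 0, by rcases min_choice a 0 with h | h <;> rwa [h], min_le_right _ _,
        mem_nhdsWithin_of_mem_nhds (Ici_mem_nhds (min_lt_of_left_lt hat))⟩
    · push Not at h
      exact ⟨t, ht, h 0 h0, Filter.mem_of_superset self_mem_nhdsWithin h⟩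
  obtain ⟨b, hb, hb0, hb'⟩ := hr
  obtain ⟨a, ha, ha0, ha'⟩ := hl
  exact ⟨a, ha, b, hb, ha0, hb0, Filter.inter_mem ha' hb'⟩

/-- Global existence from an a priori bound. The bound is required of the solutions of all equations
`y' = c(t) G(u, y)` with a scalar factor `c`, so that it survives the multiplication of `G` by a
cutoff function, which makes the field bounded. -/
theorem exists_hasDerivWithinAt_of_apriori_bound {G : U × E → E} (hG : ContDiff ℝ ∞ G) {I : Set ℝ}
    (hI : I.OrdConnected) (h0 : (0 : ℝ) ∈ I) {u : ℝ → U} (hu : ContinuousOn u I) (y₀ : E) (ρ : ℝ)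
    (hρ : ∀ J ⊆ I, J.OrdConnected → (0 : ℝ) ∈ J → ∀ (c : ℝ → ℝ) (y : ℝ → E), y 0 = y₀ →
      (∀ t ∈ J, HasDerivWithinAt y (c t • G (u t, y t)) J t) → ∀ t ∈ J, ‖y t‖ ≤ ρ) :
    ∃ y : ℝ → E, y 0 = y₀ ∧ ∀ t ∈ I, HasDerivWithinAt y (G (u t, y t)) I t := by
  -- The cutoff equals one on a neighbourhood of the ball to which all solutions are confined.
  let χ : ContDiffBump (0 : E) := ⟨max ρ 0 + 1, max ρ 0 + 2, by positivity, by linarith⟩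
  have hχ : ContDiff ℝ ∞ fun p : U × E => χ p.2 • G p :=
    (χ.contDiff.comp contDiff_snd).smul hG
  have bdd : ∀ M, ∃ L, ∀ v : U, ‖v‖ ≤ M → ∀ x, ‖χ x • G (v, x)‖ ≤ L := by
    intro M
    obtain ⟨L, hL⟩ := ((isCompact_closedBall (0 : U) M).prod
      (isCompact_closedBall (0 : E) (max ρ 0 + 2))).exists_bound_of_continuousOn
      hχ.continuous.continuousOn
    refine ⟨max L 0, fun v hv x => ?_⟩
    by_cases hx : ‖x‖ ≤ max ρ 0 + 2
    · exact (hL (v, x) ⟨by simpa using hv, by simpa using hx⟩).trans (le_max_left _ _)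
    · rw [χ.zero_of_le_dist (by rw [dist_zero_right]; exact (not_le.1 hx).le)]
      simp
  have loc : ∀ a ∈ I, ∀ b ∈ I, a ≤ 0 → 0 ≤ b → ∃ y : ℝ → E, y 0 = y₀ ∧
      ∀ t ∈ Icc a b, HasDerivWithinAt y (G (u t, y t)) (Icc a b) t := by
    intro a ha b hb ha0 hb0
    have hs : Icc a b ⊆ I := hI.out ha hb
    obtain ⟨y, hy0, hy⟩ := exists_hasDerivWithinAt_Icc_of_bounded hχ bdd ha0 hb0 (hu.mono hs) y₀
    refine ⟨y, hy0, fun t ht => ?_⟩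
    have h := hρ _ hs ordConnected_Icc ⟨ha0, hb0⟩ (fun t => χ (y t)) y hy0 hy t ht
    have h1 : χ (y t) = 1 := χ.one_of_mem_closedBall (by
      rw [mem_closedBall_zero_iff]
      exact h.trans ((le_max_left ρ 0).trans (le_add_of_nonneg_right zero_le_one)))
    simpa [h1] using hy t ht
  choose! Y hY0 hY using loc
  have agree : ∀ a ∈ I, ∀ b ∈ I, ∀ a' ∈ I, ∀ b' ∈ I, a ≤ 0 → 0 ≤ b → a' ≤ 0 → 0 ≤ b' →
      EqOn (Y a b) (Y a' b') (Icc a b ∩ Icc a' b') := by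
    intro a ha b hb a' ha' b' hb' h1 h2 h3 h4
    refine eqOn_of_hasDerivWithinAt hG (ordConnected_Icc.inter ordConnected_Icc)
      ⟨⟨h1, h2⟩, h3, h4⟩ (hu.mono (inter_subset_left.trans (hI.out ha hb))) ?_ ?_ ?_
    · rw [hY0 a ha b hb h1 h2, hY0 a' ha' b' hb' h3 h4]
    · exact fun t ht => (hY a ha b hb h1 h2 t ht.1).mono inter_subset_left
    · exact fun t ht => (hY a' ha' b' hb' h3 h4 t ht.2).mono inter_subset_right
  have hmin : ∀ t ∈ I, min t 0 ∈ I := fun t ht => by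
    rcases min_choice t 0 with h | h <;> rwa [h]
  have hmax : ∀ t ∈ I, max t 0 ∈ I := fun t ht => by
    rcases max_choice t 0 with h | h <;> rwa [h]
  have glue : ∀ a ∈ I, ∀ b ∈ I, a ≤ 0 → 0 ≤ b →
      EqOn (fun t => Y (min t 0) (max t 0) t) (Y a b) (Icc a b) := fun a ha b hb ha0 hb0 t ht =>
    agree _ (hmin t (hI.out ha hb ht)) _ (hmax t (hI.out ha hb ht)) a ha b hb (min_le_right _ _)
      (le_max_right _ _) ha0 hb0 ⟨⟨min_le_left _ _, le_max_left _ _⟩, ht⟩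
  refine ⟨fun t => Y (min t 0) (max t 0) t, ?_, fun t ht => ?_⟩
  · simpa using hY0 0 h0 0 h0 le_rfl le_rfl
  · obtain ⟨a, ha, b, hb, ha0, hb0, hab⟩ := exists_Icc_mem_nhdsWithin h0 ht
    have htab : t ∈ Icc a b := mem_of_mem_nhdsWithin ht hab
    have := (hY a ha b hb ha0 hb0 t htab).congr (glue a ha b hb ha0 hb0)
      (glue a ha b hb ha0 hb0 htab)
    rw [← glue a ha b hb ha0 hb0 htab] at this
    exact this.mono_of_mem_nhdsWithin hab

end ODE

/-- Solutions of a smooth equation with smooth control are smooth. -/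
theorem contDiffOn_of_hasDerivWithinAt {E U : Type*} [NormedAddCommGroup E] [NormedSpace ℝ E]
    [NormedAddCommGroup U] [NormedSpace ℝ U] {G : U × E → E} (hG : ContDiff ℝ ∞ G) {I : Set ℝ}
    (hI : UniqueDiffOn ℝ I) {u : ℝ → U} (hu : ContDiffOn ℝ ∞ u I) {y : ℝ → E}
    (hy : ∀ t ∈ I, HasDerivWithinAt y (G (u t, y t)) I t) : ContDiffOn ℝ ∞ y I := by
  rw [contDiffOn_infty]
  intro m
  induction m with
  | zero =>
    exact contDiffOn_zero.2 fun t ht => (hy t ht).continuousWithinAt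
  | succ m ih =>
    push_cast
    rw [contDiffOn_succ_iff_derivWithin hI]
    refine ⟨fun t ht => (hy t ht).differentiableWithinAt, by simp, ?_⟩
    refine ContDiffOn.congr (f := fun t => G (u t, y t)) ?_
      fun t ht => (hy t ht).derivWithin (hI t ht)
    exact (hG.of_le (by exact_mod_cast le_top)).comp_contDiffOn
      ((hu.of_le (by exact_mod_cast le_top)).prodMk ih)

/-! ### The Euclidean metric and the action of `O(n) × O(k)` -/

section Metric

variable {n k : ℕ}

theorem euclideanMetric_apply (V W : Mat n k) :
    euclideanMetric n k V W = 2 * (Vᵀ * W).trace := rfl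

theorem euclideanMetric_comm (V W : Mat n k) :
    euclideanMetric n k V W = euclideanMetric n k W V := by
  rw [euclideanMetric_apply, euclideanMetric_apply, ← Matrix.trace_transpose]
  simp

theorem euclideanMetric_self (V : Mat n k) :
    euclideanMetric n k V V = 2 * ∑ j, ∑ i, V i j ^ 2 := by
  simp [euclideanMetric_apply, Matrix.trace, Matrix.mul_apply, sq]

theorem euclideanMetric_self_eq_zero {V : Mat n k} (h : euclideanMetric n k V V = 0) : V = 0 := by
  have h' : (Vᵀ * V).trace = 0 := by rw [euclideanMetric_apply] at h; linarith
  exact (Matrix.trace_conjTranspose_mul_self_eq_zero_iff (A := V)).1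
    (by rwa [Matrix.conjTranspose_eq_transpose_of_trivial])

theorem euclideanMetric_isRefl : (euclideanMetric n k).IsRefl := fun V W h => by
  rwa [euclideanMetric_comm]

theorem euclideanMetric_nondegenerate : (euclideanMetric n k).Nondegenerate :=
  ⟨fun _ h => euclideanMetric_self_eq_zero (h _), fun _ h => euclideanMetric_self_eq_zero (h _)⟩

theorem eq_zero_of_mem_of_mem_orthogonal {F : Submodule ℝ (Mat n k)} {V : Mat n k} (hV : V ∈ F)
    (hV' : V ∈ (euclideanMetric n k).orthogonal F) : V = 0 :=
  euclideanMetric_self_eq_zero (hV' V hV)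

theorem orthogonal_normalSpaceSt (X : Mat n k) :
    (euclideanMetric n k).orthogonal (normalSpaceSt X) = tangentSpaceSt X :=
  LinearMap.BilinForm.orthogonal_orthogonal euclideanMetric_nondegenerate euclideanMetric_isRefl _

theorem sq_norm_le_euclideanMetric_self (V : Mat n k) : ‖V‖ ^ 2 ≤ euclideanMetric n k V V := by
  have h0 : 0 ≤ ∑ j, ∑ i, V i j ^ 2 :=
    Finset.sum_nonneg fun _ _ => Finset.sum_nonneg fun _ _ => sq_nonneg _
  rw [euclideanMetric_self, ← Real.le_sqrt (norm_nonneg _) (by linarith),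
    Matrix.norm_le_iff (Real.sqrt_nonneg _)]
  intro i j
  refine Real.le_sqrt_of_sq_le ?_
  rw [Real.norm_eq_abs, sq_abs]
  calc V i j ^ 2 ≤ ∑ i, V i j ^ 2 :=
        Finset.single_le_sum (f := fun i => V i j ^ 2) (fun _ _ => sq_nonneg _) (Finset.mem_univ i)
    _ ≤ ∑ j, ∑ i, V i j ^ 2 :=
        Finset.single_le_sum (f := fun j => ∑ i, V i j ^ 2)
          (fun _ _ => Finset.sum_nonneg fun _ _ => sq_nonneg _) (Finset.mem_univ j)
    _ ≤ 2 * ∑ j, ∑ i, V i j ^ 2 := by linarith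

theorem euclideanMetric_self_le (V : Mat n k) :
    euclideanMetric n k V V ≤ 2 * (k * n) * ‖V‖ ^ 2 := by
  rw [euclideanMetric_self, mul_assoc]
  refine mul_le_mul_of_nonneg_left ?_ zero_le_two
  calc ∑ j, ∑ i, V i j ^ 2 ≤ ∑ _j : Fin k, ∑ _i : Fin n, ‖V‖ ^ 2 := by
        refine Finset.sum_le_sum fun j _ => Finset.sum_le_sum fun i _ => ?_
        rw [← sq_abs, ← Real.norm_eq_abs]
        gcongr
        exact Matrix.norm_entry_le_entrywise_sup_norm V
    _ = k * n * ‖V‖ ^ 2 := by simp; ring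

/-- Maps which preserve the metric are bounded for the entrywise sup norm, by a constant that depends
only on the size of the matrices. -/
theorem norm_le_of_euclideanMetric_self_eq {V W : Mat n k}
    (h : euclideanMetric n k V V = euclideanMetric n k W W) : ‖V‖ ≤ √(2 * (k * n)) * ‖W‖ := by
  refine le_of_sq_le_sq ?_ (by positivity)
  rw [mul_pow, Real.sq_sqrt (by positivity)]
  exact (sq_norm_le_euclideanMetric_self V).trans (h ▸ euclideanMetric_self_le W)

/-- `fMap` as a continuous bilinear map. -/
noncomputable def fMapL (n k : ℕ) : (Mat n n × Mat k k) →L[ℝ] Mat n k →L[ℝ] Mat n k :=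
  LinearMap.toContinuousBilinearMap <|
    LinearMap.mk₂ ℝ (fun ξ V => fMap ξ V)
      (fun ξ ζ V => by simp [fMap, Matrix.add_mul, Matrix.mul_add]; abel)
      (fun c ξ V => by simp [fMap, smul_sub])
      (fun ξ V W => by simp [fMap, Matrix.add_mul, Matrix.mul_add]; abel)
      (fun c ξ V => by simp [fMap, smul_sub])

theorem fMap_smul (c : ℝ) (ξ : Mat n n × Mat k k) (V : Mat n k) :
    fMap (c • ξ) V = c • fMap ξ V := by
  simp [fMap, smul_sub]

/-- The pair of matrices lies in `so(n) × so(k)`. -/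
def IsSkewPair (ξ : Mat n n × Mat k k) : Prop := ξ.1ᵀ = -ξ.1 ∧ ξ.2ᵀ = -ξ.2

theorem isSkewPair_soInclusion (ξ : SoPair n k) : IsSkewPair (soInclusion n k ξ) :=
  ⟨so_transpose ξ.1, so_transpose ξ.2⟩

theorem IsSkewPair.smul {ξ : Mat n n × Mat k k} (h : IsSkewPair ξ) (c : ℝ) :
    IsSkewPair (c • ξ) := by
  constructor <;> simp [h.1, h.2]

/-- `f_ξ` is the infinitesimal action of `so(n) × so(k)`, hence skew-adjoint. -/
theorem IsSkewPair.euclideanMetric_fMap {ξ : Mat n n × Mat k k} (h : IsSkewPair ξ)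
    (V W : Mat n k) : euclideanMetric n k (fMap ξ V) W + euclideanMetric n k V (fMap ξ W) = 0 := by
  have h1 : (ξ.2ᵀ * (Vᵀ * W)).trace = -(Vᵀ * (W * ξ.2)).trace := by
    rw [h.2, Matrix.neg_mul, Matrix.trace_neg, Matrix.trace_mul_comm, Matrix.mul_assoc]
  simp only [euclideanMetric_apply, fMap, Matrix.transpose_sub, Matrix.transpose_mul,
    Matrix.sub_mul, Matrix.mul_sub, Matrix.trace_sub, Matrix.mul_assoc, h1]
  rw [h.1]
  simp only [Matrix.neg_mul, Matrix.mul_neg, Matrix.trace_neg]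
  ring

theorem IsOrthogonalPair.transpose_mul_self {q : Mat n n × Mat k k} (h : IsOrthogonalPair q) :
    q.1ᵀ * q.1 = 1 ∧ q.2ᵀ * q.2 = 1 :=
  ⟨(Matrix.mem_orthogonalGroup_iff' _ _).1 h.1, (Matrix.mem_orthogonalGroup_iff' _ _).1 h.2⟩

theorem IsOrthogonalPair.mul_transpose_self {q : Mat n n × Mat k k} (h : IsOrthogonalPair q) :
    q.1 * q.1ᵀ = 1 ∧ q.2 * q.2ᵀ = 1 :=
  ⟨(Matrix.mem_orthogonalGroup_iff _ _).1 h.1, (Matrix.mem_orthogonalGroup_iff _ _).1 h.2⟩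

theorem stiefelAction_apply (q : Mat n n × Mat k k) (V : Mat n k) :
    stiefelAction q V = q.1 * V * q.2ᵀ := rfl

theorem IsOrthogonalPair.transpose_mul_stiefelAction {q : Mat n n × Mat k k}
    (h : IsOrthogonalPair q) (V : Mat n k) : q.1ᵀ * stiefelAction q V * q.2 = V := by
  obtain ⟨h1, h2⟩ := h.transpose_mul_self
  simp only [stiefelAction_apply, ← Matrix.mul_assoc, h1, Matrix.one_mul]
  rw [Matrix.mul_assoc, h2, Matrix.mul_one]

theorem IsOrthogonalPair.transpose_stiefelAction_mul {q : Mat n n × Mat k k}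
    (h : IsOrthogonalPair q) (V W : Mat n k) :
    (stiefelAction q V)ᵀ * stiefelAction q W = q.2 * (Vᵀ * W) * q.2ᵀ := by
  have h1 : q.1ᵀ * (q.1 * (W * q.2ᵀ)) = W * q.2ᵀ := by
    rw [← Matrix.mul_assoc, h.transpose_mul_self.1, Matrix.one_mul]
  simp only [stiefelAction_apply, Matrix.transpose_mul, Matrix.transpose_transpose,
    Matrix.mul_assoc, h1]

theorem IsOrthogonalPair.euclideanMetric_stiefelAction {q : Mat n n × Mat k k}
    (h : IsOrthogonalPair q) (V W : Mat n k) :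
    euclideanMetric n k (stiefelAction q V) (stiefelAction q W) = euclideanMetric n k V W := by
  rw [euclideanMetric_apply, euclideanMetric_apply, h.transpose_stiefelAction_mul,
    Matrix.trace_mul_comm, ← Matrix.mul_assoc, h.transpose_mul_self.2, Matrix.one_mul]

theorem IsOrthogonalPair.stiefelAction_surjective {q : Mat n n × Mat k k}
    (h : IsOrthogonalPair q) : Function.Surjective (stiefelAction (n := n) (k := k) q) := by
  intro W
  refine ⟨q.1ᵀ * W * q.2, ?_⟩
  obtain ⟨h1, h2⟩ := h.mul_transpose_self
  simp only [stiefelAction_apply, ← Matrix.mul_assoc, h1, Matrix.one_mul]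
  rw [Matrix.mul_assoc, h2, Matrix.mul_one]

theorem IsOrthogonalPair.stiefelAction_mem_stiefel {q : Mat n n × Mat k k}
    (h : IsOrthogonalPair q) {X : Mat n k} (hX : X ∈ stiefel n k) :
    stiefelAction q X ∈ stiefel n k := by
  have hX' : Xᵀ * X = 1 := hX
  change (stiefelAction q X)ᵀ * stiefelAction q X = 1
  rw [h.transpose_stiefelAction_mul, hX', Matrix.mul_one, h.mul_transpose_self.2]

theorem IsOrthogonalPair.map_tangentSpaceSt {q : Mat n n × Mat k k} (h : IsOrthogonalPair q)
    (X : Mat n k) :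
    (tangentSpaceSt X).map (stiefelAction q) = tangentSpaceSt (stiefelAction q X) := by
  have key : ∀ V, stiefelAction q V ∈ tangentSpaceSt (stiefelAction q X) ↔
      V ∈ tangentSpaceSt X := by
    intro V
    rw [mem_tangentSpaceSt, mem_tangentSpaceSt, h.transpose_stiefelAction_mul,
      h.transpose_stiefelAction_mul, ← Matrix.add_mul, ← Matrix.mul_add]
    refine ⟨fun e => ?_, fun e => by simp [e]⟩
    have := congrArg (fun M => q.2ᵀ * M * q.2) e
    simpa only [← Matrix.mul_assoc, h.transpose_mul_self.2, Matrix.one_mul, Matrix.mul_zero,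
      Matrix.zero_mul, Matrix.mul_assoc _ q.2ᵀ q.2, Matrix.mul_one] using this
  ext W
  obtain ⟨V, rfl⟩ := h.stiefelAction_surjective W
  rw [key]
  refine ⟨?_, fun hV => ⟨V, hV, rfl⟩⟩
  rintro ⟨V', hV', e⟩
  rw [← key, ← e, key]
  exact hV'

theorem IsOrthogonalPair.mem_orthogonal_map {q : Mat n n × Mat k k} (h : IsOrthogonalPair q)
    (F : Submodule ℝ (Mat n k)) (V : Mat n k) :
    stiefelAction q V ∈ (euclideanMetric n k).orthogonal (F.map (stiefelAction q)) ↔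
      V ∈ (euclideanMetric n k).orthogonal F := by
  constructor
  · intro hV W hW
    have := hV _ (Submodule.mem_map_of_mem hW)
    rwa [h.euclideanMetric_stiefelAction] at this
  · rintro hV _ ⟨W, hW, rfl⟩
    rw [h.euclideanMetric_stiefelAction]
    exact hV W hW

theorem IsOrthogonalPair.map_normalSpaceSt {q : Mat n n × Mat k k} (h : IsOrthogonalPair q)
    (X : Mat n k) :
    (normalSpaceSt X).map (stiefelAction q) = normalSpaceSt (stiefelAction q X) := by
  rw [normalSpaceSt, normalSpaceSt, ← h.map_tangentSpaceSt]
  ext W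
  obtain ⟨V, rfl⟩ := h.stiefelAction_surjective W
  rw [h.mem_orthogonal_map]
  refine ⟨?_, fun hV => ⟨V, hV, rfl⟩⟩
  rintro ⟨V', hV', e⟩
  have : V' = V := by
    rw [← h.transpose_mul_stiefelAction V, ← e, h.transpose_mul_stiefelAction]
  exact this ▸ hV'

end Metric

/-! ### Curves of matrices -/

section Curves

variable {n m k : ℕ}

/-- Matrix multiplication as a continuous bilinear map. -/
noncomputable def matMulL (n m k : ℕ) : Mat n m →L[ℝ] Mat m k →L[ℝ] Mat n k :=
  LinearMap.toContinuousBilinearMap <|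
    LinearMap.mk₂ ℝ (fun A B => A * B) (fun _ _ _ => Matrix.add_mul _ _ _) (fun _ _ _ => by simp)
      (fun _ _ _ => Matrix.mul_add _ _ _) (fun _ _ _ => by simp)

theorem HasDerivWithinAt.matrix_mul {A : ℝ → Mat n m} {B : ℝ → Mat m k} {A' : Mat n m}
    {B' : Mat m k} {s : Set ℝ} {t : ℝ} (hA : HasDerivWithinAt A A' s t)
    (hB : HasDerivWithinAt B B' s t) :
    HasDerivWithinAt (fun t => A t * B t) (A t * B' + A' * B t) s t :=
  (matMulL n m k).hasDerivWithinAt_of_bilinear hA hB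

theorem ContDiffOn.matrix_mul {A : ℝ → Mat n m} {B : ℝ → Mat m k} {s : Set ℝ}
    (hA : ContDiffOn ℝ ∞ A s) (hB : ContDiffOn ℝ ∞ B s) :
    ContDiffOn ℝ ∞ (fun t => A t * B t) s :=
  (matMulL n m k).isBoundedBilinearMap.contDiff.comp_contDiffOn (hA.prodMk hB)

/-- Matrix transposition as a continuous linear map. -/
noncomputable def matTransposeL (n m : ℕ) : Mat n m →L[ℝ] Mat m n :=
  LinearMap.toContinuousLinearMap (Matrix.transposeLinearEquiv (Fin n) (Fin m) ℝ ℝ).toLinearMap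

theorem HasDerivWithinAt.matrix_transpose {A : ℝ → Mat n m} {A' : Mat n m} {s : Set ℝ} {t : ℝ}
    (hA : HasDerivWithinAt A A' s t) : HasDerivWithinAt (fun t => (A t)ᵀ) A'ᵀ s t :=
  (matTransposeL n m).hasFDerivAt.comp_hasDerivWithinAt t hA

theorem ContDiffOn.matrix_transpose {A : ℝ → Mat n m} {s : Set ℝ} (hA : ContDiffOn ℝ ∞ A s) :
    ContDiffOn ℝ ∞ (fun t => (A t)ᵀ) s :=
  (matTransposeL n m).contDiff.comp_contDiffOn hA

theorem Submodule.exists_continuousLinearMap_retraction (F : Submodule ℝ (Mat n k)) :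
    ∃ P : Mat n k →L[ℝ] F, ∀ Z : F, P Z = Z := by
  obtain ⟨P, hP⟩ := F.subtype.exists_leftInverse_of_injective F.ker_subtype
  exact ⟨LinearMap.toContinuousLinearMap P, fun Z => LinearMap.congr_fun hP Z⟩

theorem Submodule.contDiffOn_coe_iff {F : Submodule ℝ (Mat n k)} {Z : ℝ → F} {s : Set ℝ} :
    ContDiffOn ℝ ∞ (fun t => (Z t : Mat n k)) s ↔ ContDiffOn ℝ ∞ Z s := by
  refine ⟨fun h => ?_, fun h => F.subtypeL.contDiff.comp_contDiffOn h⟩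
  obtain ⟨P, hP⟩ := F.exists_continuousLinearMap_retraction
  exact (P.contDiff.comp_contDiffOn h).congr fun t _ => (hP _).symm

theorem HasDerivWithinAt.submodule_coe {F : Submodule ℝ (Mat n k)} {Z : ℝ → F} {Z' : F}
    {s : Set ℝ} {t : ℝ} (h : HasDerivWithinAt Z Z' s t) :
    HasDerivWithinAt (fun t => (Z t : Mat n k)) (Z' : Mat n k) s t :=
  F.subtypeL.hasFDerivAt.comp_hasDerivWithinAt t h

theorem eq_of_hasDerivWithinAt_zero {J : Set ℝ} (hJ : J.OrdConnected) {E : Type*}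
    [NormedAddCommGroup E] [NormedSpace ℝ E] {f f' : ℝ → E}
    (hf : ∀ t ∈ J, HasDerivWithinAt f (f' t) J t) (hf' : ∀ t ∈ J, f' t = 0) {a b : ℝ} (ha : a ∈ J)
    (hb : b ∈ J) : f a = f b := by
  have := hJ.convex.norm_image_sub_le_of_norm_hasDerivWithin_le (C := 0) hf
    (fun t ht => by simp [hf' t ht]) hb ha
  rwa [zero_mul, norm_le_zero_iff, sub_eq_zero] at this

end Curves

/-! ### Curves of endomorphisms of a finite-dimensional space -/

section ProductCurves

variable {F M : Type*} [NormedAddCommGroup F] [NormedSpace ℝ F] [NormedAddCommGroup M]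
  [NormedSpace ℝ M] {y : ℝ → F × M} {y' : F × M} {s : Set ℝ} {t : ℝ}

theorem HasDerivWithinAt.proj_fst (h : HasDerivWithinAt y y' s t) :
    HasDerivWithinAt (fun t => (y t).1) y'.1 s t :=
  (ContinuousLinearMap.fst ℝ F M).hasFDerivAt.comp_hasDerivWithinAt t h

theorem HasDerivWithinAt.proj_snd (h : HasDerivWithinAt y y' s t) :
    HasDerivWithinAt (fun t => (y t).2) y'.2 s t :=
  (ContinuousLinearMap.snd ℝ F M).hasFDerivAt.comp_hasDerivWithinAt t h

end ProductCurves

section LinearMapCurves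

variable {F F' : Type*} [NormedAddCommGroup F] [NormedSpace ℝ F] [FiniteDimensional ℝ F]
  [NormedAddCommGroup F'] [NormedSpace ℝ F']

theorem hasDerivWithinAt_clm_of_apply [FiniteDimensional ℝ F'] {f : ℝ → F →L[ℝ] F'}
    {f' : F →L[ℝ] F'} {s : Set ℝ} {t : ℝ}
    (h : ∀ Z, HasDerivWithinAt (fun t => f t Z) (f' Z) s t) : HasDerivWithinAt f f' s t := by
  let b := Module.finBasis ℝ F
  let ev : (F →L[ℝ] F') →ₗ[ℝ] (Fin (Module.finrank ℝ F) → F') :=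
    LinearMap.pi fun i => (ContinuousLinearMap.apply ℝ F' (b i)).toLinearMap
  have hev : LinearMap.ker ev = ⊥ := by
    rw [LinearMap.ker_eq_bot']
    intro A hA
    have : (A : F →ₗ[ℝ] F') = 0 := b.ext fun i => congrFun hA i
    exact ContinuousLinearMap.coe_injective this
  obtain ⟨P, hP⟩ := ev.exists_leftInverse_of_injective hev
  have hP' : ∀ A, P (ev A) = A := fun A => LinearMap.congr_fun hP A
  have h1 : HasDerivWithinAt (fun t => ev (f t)) (ev f') s t :=
    hasDerivWithinAt_pi.2 fun i => h (b i)
  have h2 := (LinearMap.toContinuousLinearMap P).hasFDerivAt.comp_hasDerivWithinAt t h1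
  simpa [Function.comp_def, hP'] using h2

/-- The product rule for a pointwise differentiable curve of linear maps. -/
theorem hasDerivWithinAt_linearMap_apply [FiniteDimensional ℝ F'] {A : ℝ → F →ₗ[ℝ] F'}
    {Z : ℝ → F} {Z' : F} {s : Set ℝ} {t : ℝ} (hs : UniqueDiffWithinAt ℝ s t)
    (hA : ∀ Z, DifferentiableWithinAt ℝ (fun t => A t Z) s t) (hZ : HasDerivWithinAt Z Z' s t) :
    HasDerivWithinAt (fun t => A t (Z t)) (derivWithin (fun r => A r (Z t)) s t + A t Z') s t := by
  let A' : F →ₗ[ℝ] F' :=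
    { toFun := fun Z => derivWithin (fun r => A r Z) s t
      map_add' := fun Z W => by
        simp only [map_add]
        exact ((hA Z).hasDerivWithinAt.add (hA W).hasDerivWithinAt).derivWithin hs
      map_smul' := fun c Z => by
        simp only [map_smul]
        exact ((hA Z).hasDerivWithinAt.const_smul c).derivWithin hs }
  have h : HasDerivWithinAt (fun t => LinearMap.toContinuousLinearMap (A t))
      (LinearMap.toContinuousLinearMap A') s t :=
    hasDerivWithinAt_clm_of_apply fun Z => (hA Z).hasDerivWithinAt
  exact h.clm_apply hZ

theorem contDiffOn_linearMap_apply {A : ℝ → F →ₗ[ℝ] F'} {Z : ℝ → F} {s : Set ℝ}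
    (hA : ∀ Z, ContDiffOn ℝ ∞ (fun t => A t Z) s) (hZ : ContDiffOn ℝ ∞ Z s) :
    ContDiffOn ℝ ∞ (fun t => A t (Z t)) s := by
  have h : ContDiffOn ℝ ∞ (fun t => LinearMap.toContinuousLinearMap (A t)) s :=
    contDiffOn_clm_apply.2 hA
  exact h.clm_apply hZ

theorem contDiffOn_linearMap_apply_iff {A : ℝ → F →ₗ[ℝ] F} {Z : ℝ → F} {s : Set ℝ}
    (hA : ∀ Z, ContDiffOn ℝ ∞ (fun t => A t Z) s) (hA' : ∀ t ∈ s, Function.Bijective (A t)) :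
    ContDiffOn ℝ ∞ (fun t => A t (Z t)) s ↔ ContDiffOn ℝ ∞ Z s := by
  refine ⟨fun h => ?_, contDiffOn_linearMap_apply hA⟩
  let L : ℝ → F →L[ℝ] F := fun t => LinearMap.toContinuousLinearMap (A t)
  have hL : ContDiffOn ℝ ∞ L s := contDiffOn_clm_apply.2 hA
  let e : ∀ t ∈ s, F ≃L[ℝ] F := fun t ht =>
    (LinearEquiv.ofBijective (A t) (hA' t ht)).toContinuousLinearEquiv
  have he : ∀ t (ht : t ∈ s), (e t ht : F →L[ℝ] F) = L t := fun t ht => rfl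
  have hi : ContDiffOn ℝ ∞ (fun t => (L t).inverse) s := fun t ht => by
    have := contDiffAt_map_inverse (𝕜 := ℝ) (n := ∞) (e t ht)
    rw [he t ht] at this
    exact this.comp_contDiffWithinAt t (hL t ht)
  refine (hi.clm_apply h).congr fun t ht => ?_
  rw [← he t ht, ContinuousLinearMap.inverse_equiv]
  exact ((e t ht).symm_apply_apply (Z t)).symm

end LinearMapCurves

/-! ### Coupled transport equations -/

section TransportSystem

variable {F₁ F₂ M : Type*} [NormedAddCommGroup F₁] [NormedSpace ℝ F₁] [FiniteDimensional ℝ F₁]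
  [NormedAddCommGroup F₂] [NormedSpace ℝ F₂] [FiniteDimensional ℝ F₂]
  [NormedAddCommGroup M] [NormedSpace ℝ M] [FiniteDimensional ℝ M]

/-- The curves `A`, `q`, `T` solve the system `A' = -c D₁(A v) A`, `q' = c m(A v) q`,
`T' = -c D₂(A v) T` on `J` with initial values `id`, `q₀`, `id`. Here `c` is a scalar factor. -/
structure IsTransportSolution (D₁ : F₁ →ₗ[ℝ] F₁ →ₗ[ℝ] F₁) (m : F₁ →ₗ[ℝ] M →ₗ[ℝ] M)
    (D₂ : F₁ →ₗ[ℝ] F₂ →ₗ[ℝ] F₂) (q₀ : M) (J : Set ℝ) (c : ℝ → ℝ) (v : ℝ → F₁)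
    (A : ℝ → F₁ →ₗ[ℝ] F₁) (q : ℝ → M) (T : ℝ → F₂ →ₗ[ℝ] F₂) : Prop where
  init_A : A 0 = LinearMap.id
  init_q : q 0 = q₀
  init_T : T 0 = LinearMap.id
  deriv_A : ∀ t ∈ J, ∀ Z,
    HasDerivWithinAt (fun s => A s Z) (-(c t • D₁ (A t (v t)) (A t Z))) J t
  deriv_q : ∀ t ∈ J, HasDerivWithinAt q (c t • m (A t (v t)) (q t)) J t
  deriv_T : ∀ t ∈ J, ∀ Z,
    HasDerivWithinAt (fun s => T s Z) (-(c t • D₂ (A t (v t)) (T t Z))) J t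

/-- The field whose integral curves are the solutions of `IsTransportSolution`. -/
noncomputable def transportField (D₁ : F₁ →ₗ[ℝ] F₁ →ₗ[ℝ] F₁) (m : F₁ →ₗ[ℝ] M →ₗ[ℝ] M)
    (D₂ : F₁ →ₗ[ℝ] F₂ →ₗ[ℝ] F₂) (p : F₁ × ((F₁ →L[ℝ] F₁) × M × (F₂ →L[ℝ] F₂))) :
    (F₁ →L[ℝ] F₁) × M × (F₂ →L[ℝ] F₂) :=
  (-((LinearMap.toContinuousBilinearMap D₁ (p.2.1 p.1)).comp p.2.1),
    LinearMap.toContinuousBilinearMap m (p.2.1 p.1) p.2.2.1,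
    -((LinearMap.toContinuousBilinearMap D₂ (p.2.1 p.1)).comp p.2.2.2))

variable (D₁ : F₁ →ₗ[ℝ] F₁ →ₗ[ℝ] F₁) (m : F₁ →ₗ[ℝ] M →ₗ[ℝ] M) (D₂ : F₁ →ₗ[ℝ] F₂ →ₗ[ℝ] F₂)

theorem contDiff_transportField : ContDiff ℝ ∞ (transportField D₁ m D₂) := by
  have h : ContDiff ℝ ∞ fun p : F₁ × ((F₁ →L[ℝ] F₁) × M × (F₂ →L[ℝ] F₂)) => p.2.1 p.1 :=
    (contDiff_fst.comp contDiff_snd).clm_apply contDiff_fst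
  refine ContDiff.prodMk ?_ (ContDiff.prodMk ?_ ?_)
  · exact (((ContinuousLinearMap.contDiff _).comp h).clm_comp
      (contDiff_fst.comp contDiff_snd)).neg
  · exact ((ContinuousLinearMap.contDiff _).comp h).clm_apply
      (contDiff_fst.comp (contDiff_snd.comp contDiff_snd))
  · exact (((ContinuousLinearMap.contDiff _).comp h).clm_comp
      (contDiff_snd.comp (contDiff_snd.comp contDiff_snd))).neg

variable {D₁ m D₂} {q₀ : M} {J : Set ℝ} {v : ℝ → F₁}

theorem IsTransportSolution.hasDerivWithinAt {c : ℝ → ℝ} {A : ℝ → F₁ →ₗ[ℝ] F₁} {q : ℝ → M}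
    {T : ℝ → F₂ →ₗ[ℝ] F₂} (h : IsTransportSolution D₁ m D₂ q₀ J c v A q T) {t : ℝ} (ht : t ∈ J) :
    HasDerivWithinAt (fun t => (LinearMap.toContinuousLinearMap (A t), q t,
        LinearMap.toContinuousLinearMap (T t)))
      (c t • transportField D₁ m D₂ (v t, LinearMap.toContinuousLinearMap (A t), q t,
        LinearMap.toContinuousLinearMap (T t))) J t := by
  have hA : HasDerivWithinAt (fun t => LinearMap.toContinuousLinearMap (A t))
      (c t • (transportField D₁ m D₂ (v t, LinearMap.toContinuousLinearMap (A t), q t,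
        LinearMap.toContinuousLinearMap (T t))).1) J t :=
    hasDerivWithinAt_clm_of_apply fun Z => by simpa [transportField] using h.deriv_A t ht Z
  have hT : HasDerivWithinAt (fun t => LinearMap.toContinuousLinearMap (T t))
      (c t • (transportField D₁ m D₂ (v t, LinearMap.toContinuousLinearMap (A t), q t,
        LinearMap.toContinuousLinearMap (T t))).2.2) J t :=
    hasDerivWithinAt_clm_of_apply fun Z => by simpa [transportField] using h.deriv_T t ht Z
  exact hA.prodMk ((h.deriv_q t ht).prodMk hT)

theorem isTransportSolution_of_hasDerivWithinAt {c : ℝ → ℝ}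
    {y : ℝ → (F₁ →L[ℝ] F₁) × M × (F₂ →L[ℝ] F₂)}
    (h0 : y 0 = (ContinuousLinearMap.id ℝ F₁, q₀, ContinuousLinearMap.id ℝ F₂))
    (hy : ∀ t ∈ J, HasDerivWithinAt y (c t • transportField D₁ m D₂ (v t, y t)) J t) :
    IsTransportSolution D₁ m D₂ q₀ J c v (fun t => (y t).1) (fun t => (y t).2.1)
      (fun t => (y t).2.2) where
  init_A := by rw [h0]; rfl
  init_q := by rw [h0]
  init_T := by rw [h0]; rfl
  deriv_A t ht Z := by
    simpa [transportField] using (hy t ht).proj_fst.clm_apply (hasDerivWithinAt_const t J Z)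
  deriv_q t ht := by
    simpa [transportField] using (hy t ht).proj_snd.proj_fst
  deriv_T t ht Z := by
    simpa [transportField] using (hy t ht).proj_snd.proj_snd.clm_apply (hasDerivWithinAt_const t J Z)

theorem IsTransportSolution.eqOn {A A' : ℝ → F₁ →ₗ[ℝ] F₁} {q q' : ℝ → M}
    {T T' : ℝ → F₂ →ₗ[ℝ] F₂} (hJ : J.OrdConnected) (h0 : (0 : ℝ) ∈ J) (hv : ContinuousOn v J)
    (h : IsTransportSolution D₁ m D₂ q₀ J 1 v A q T)
    (h' : IsTransportSolution D₁ m D₂ q₀ J 1 v A' q' T') :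
    Set.EqOn A A' J ∧ Set.EqOn q q' J ∧ Set.EqOn T T' J := by
  have key := eqOn_of_hasDerivWithinAt (contDiff_transportField D₁ m D₂) hJ h0 hv
    (y := fun t => (LinearMap.toContinuousLinearMap (A t), q t,
        LinearMap.toContinuousLinearMap (T t)))
    (z := fun t => (LinearMap.toContinuousLinearMap (A' t), q' t,
        LinearMap.toContinuousLinearMap (T' t)))
    (by simp only [h.init_A, h.init_q, h.init_T, h'.init_A, h'.init_q, h'.init_T])
    (fun t ht => by simpa using h.hasDerivWithinAt ht)
    (fun t ht => by simpa using h'.hasDerivWithinAt ht)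
  refine ⟨fun t ht => ?_, fun t ht => ?_, fun t ht => ?_⟩
  · exact LinearMap.toContinuousLinearMap.injective (congrArg Prod.fst (key ht))
  · exact congrArg (fun p => p.2.1) (key ht)
  · exact LinearMap.toContinuousLinearMap.injective (congrArg (fun p => p.2.2) (key ht))

/-- The system, although quadratic in `A`, has a global smooth solution if the solutions are bounded
a priori, uniformly in the scalar factor. -/
theorem exists_isTransportSolution {I : Set ℝ} (hI : I.OrdConnected) (hI' : I.Nontrivial)
    (h0 : (0 : ℝ) ∈ I) (hv : ContDiffOn ℝ ∞ v I) {ρ : ℝ} (hρ0 : 0 ≤ ρ)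
    (hρ : ∀ J ⊆ I, J.OrdConnected → (0 : ℝ) ∈ J → ∀ c A q T,
      IsTransportSolution D₁ m D₂ q₀ J c v A q T → ∀ t ∈ J,
        (∀ Z, ‖A t Z‖ ≤ ρ * ‖Z‖) ∧ ‖q t‖ ≤ ρ ∧ ∀ Z, ‖T t Z‖ ≤ ρ * ‖Z‖) :
    ∃ A q T, IsTransportSolution D₁ m D₂ q₀ I 1 v A q T ∧
      (∀ Z, ContDiffOn ℝ ∞ (fun t => A t Z) I) ∧ ContDiffOn ℝ ∞ q I ∧
      ∀ Z, ContDiffOn ℝ ∞ (fun t => T t Z) I := by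
  have hG := contDiff_transportField D₁ m D₂
  obtain ⟨y, hy0, hy⟩ := exists_hasDerivWithinAt_of_apriori_bound hG hI h0 hv.continuousOn
    (ContinuousLinearMap.id ℝ F₁, q₀, ContinuousLinearMap.id ℝ F₂) ρ (by
      intro J hJI hJ hJ0 c y hy0 hy t ht
      obtain ⟨h1, h2, h3⟩ := hρ J hJI hJ hJ0 c _ _ _
        (isTransportSolution_of_hasDerivWithinAt hy0 hy) t ht
      exact max_le ((y t).1.opNorm_le_bound hρ0 h1)
        (max_le h2 ((y t).2.2.opNorm_le_bound hρ0 h3)))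
  have hs := contDiffOn_of_hasDerivWithinAt hG (hI.uniqueDiffOn_real hI') hv hy
  refine ⟨_, _, _, isTransportSolution_of_hasDerivWithinAt (c := 1) hy0 (by simpa using hy),
    fun Z => ?_, ?_, fun Z => ?_⟩
  · exact (contDiff_fst.comp_contDiffOn hs).clm_apply contDiffOn_const
  · exact contDiff_fst.comp_contDiffOn (contDiff_snd.comp_contDiffOn hs)
  · exact (contDiff_snd.comp_contDiffOn (contDiff_snd.comp_contDiffOn hs)).clm_apply
      contDiffOn_const

end TransportSystem

/-! ### Orthogonal curves and projected transport -/

section Transport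

variable {n k : ℕ}

theorem isOrthogonalPair_of_hasDerivWithinAt {J : Set ℝ} (hJ : J.OrdConnected)
    (h0 : (0 : ℝ) ∈ J) {q ξ : ℝ → Mat n n × Mat k k} (hq0 : q 0 = (1, 1))
    (hξ : ∀ t ∈ J, IsSkewPair (ξ t))
    (hq : ∀ t ∈ J, HasDerivWithinAt q ((q t).1 * (ξ t).1, (q t).2 * (ξ t).2) J t) :
    ∀ t ∈ J, IsOrthogonalPair (q t) := by
  have key : ∀ {m : ℕ} (R Ω : ℝ → Mat m m), R 0 = 1 → (∀ t ∈ J, (Ω t)ᵀ = -Ω t) →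
      (∀ t ∈ J, HasDerivWithinAt R (R t * Ω t) J t) →
      ∀ t ∈ J, R t ∈ Matrix.orthogonalGroup (Fin m) ℝ := by
    intro m R Ω hR0 hΩ hR t ht
    have := eq_of_hasDerivWithinAt_zero hJ
      (fun t ht => (hR t ht).matrix_mul (hR t ht).matrix_transpose)
      (fun t ht => by simp [hΩ t ht, Matrix.mul_assoc]) ht h0
    rw [Matrix.mem_orthogonalGroup_iff]
    exact this.trans (by simp [hR0])
  intro t ht
  exact ⟨key _ (fun t => (ξ t).1) (by rw [hq0]) (fun t ht => (hξ t ht).1)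
      (fun t ht => (hq t ht).proj_fst) t ht,
    key _ (fun t => (ξ t).2) (by rw [hq0]) (fun t ht => (hξ t ht).2)
      (fun t ht => (hq t ht).proj_snd) t ht⟩

section BodyVelocity

variable {I : Set ℝ} {q : ℝ → Mat n n × Mat k k} {t : ℝ}

theorem bodyVelocity_eq {ξ : Mat n n × Mat k k} (h : IsOrthogonalPair (q t))
    (hq : derivWithin q I t = ((q t).1 * ξ.1, (q t).2 * ξ.2)) : bodyVelocity I q t = ξ := by
  rw [bodyVelocity, hq]
  ext1 <;> simp only [← Matrix.mul_assoc, h.transpose_mul_self, Matrix.one_mul]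

theorem derivWithin_eq_mul_bodyVelocity (h : IsOrthogonalPair (q t)) :
    derivWithin q I t = ((q t).1 * (bodyVelocity I q t).1, (q t).2 * (bodyVelocity I q t).2) := by
  simp only [bodyVelocity, ← Matrix.mul_assoc, h.mul_transpose_self, Matrix.one_mul]

theorem isSkewPair_bodyVelocity (hI : UniqueDiffOn ℝ I) (hq : DifferentiableOn ℝ q I)
    (h : ∀ t ∈ I, IsOrthogonalPair (q t)) (ht : t ∈ I) : IsSkewPair (bodyVelocity I q t) := by
  have key : ∀ {m : ℕ} (R : ℝ → Mat m m) (R' : Mat m m), (∀ t ∈ I, (R t)ᵀ * R t = 1) →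
      HasDerivWithinAt R R' I t → ((R t)ᵀ * R')ᵀ = -((R t)ᵀ * R') := by
    intro m R R' hR hR'
    have h1 := hR'.matrix_transpose.matrix_mul hR'
    have h2 : HasDerivWithinAt (fun t => (R t)ᵀ * R t) 0 I t :=
      (hasDerivWithinAt_const t I (1 : Mat m m)).congr hR (hR t ht)
    have h3 := (h1.derivWithin (hI t ht)).symm.trans (h2.derivWithin (hI t ht))
    rw [eq_neg_iff_add_eq_zero, add_comm]
    simpa using h3
  have hd := (hq t ht).hasDerivWithinAt
  exact ⟨key _ _ (fun t ht => (h t ht).transpose_mul_self.1) hd.proj_fst,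
    key _ _ (fun t ht => (h t ht).transpose_mul_self.2) hd.proj_snd⟩

end BodyVelocity

theorem hasDerivWithinAt_submodule_coe_iff {F : Submodule ℝ (Mat n k)} {Z : ℝ → F} {Z' : F}
    {s : Set ℝ} {t : ℝ} : HasDerivWithinAt (fun t => (Z t : Mat n k)) (Z' : Mat n k) s t ↔
      HasDerivWithinAt Z Z' s t := by
  refine ⟨fun h => ?_, HasDerivWithinAt.submodule_coe⟩
  obtain ⟨P, hP⟩ := F.exists_continuousLinearMap_retraction
  have := P.hasFDerivAt.comp_hasDerivWithinAt t h
  exact (this.congr_deriv (hP Z')).congr (fun r _ => (hP _).symm) (hP _).symm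

/-- A curve of endomorphisms of `F` whose derivative is `-P_F ∘ f_ξ ∘ A` with `ξ` skew preserves the
metric, since `f_ξ` is skew-adjoint. -/
theorem euclideanMetric_preserved_of_transport {F : Submodule ℝ (Mat n k)} {J : Set ℝ}
    (hJ : J.OrdConnected) (h0 : (0 : ℝ) ∈ J) {ξ : ℝ → Mat n n × Mat k k}
    (hξ : ∀ t ∈ J, IsSkewPair (ξ t)) {A : ℝ → F →ₗ[ℝ] F} {A' : ℝ → F → F}
    (hA0 : A 0 = LinearMap.id)
    (hA : ∀ t ∈ J, ∀ Z, HasDerivWithinAt (fun s => A s Z) (A' t Z) J t)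
    (hA' : ∀ t ∈ J, ∀ Z, (A' t Z : Mat n k) + fMap (ξ t) (A t Z : Mat n k) ∈
      (euclideanMetric n k).orthogonal F) {t : ℝ} (ht : t ∈ J) (Z W : F) :
    euclideanMetric n k (A t Z : Mat n k) (A t W : Mat n k) =
      euclideanMetric n k (Z : Mat n k) (W : Mat n k) := by
  have h := eq_of_hasDerivWithinAt_zero hJ
    (f := fun t => euclideanMetric n k (A t Z : Mat n k) (A t W : Mat n k))
    (fun t ht => (LinearMap.toContinuousBilinearMap
      (euclideanMetric n k)).hasDerivWithinAt_of_bilinear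
        (hA t ht Z).submodule_coe (hA t ht W).submodule_coe)
    (fun t ht => by
      have h1 : euclideanMetric n k (A t Z : Mat n k)
          ((A' t W : Mat n k) + fMap (ξ t) (A t W : Mat n k)) = 0 := hA' t ht W _ (A t Z).2
      have h2 : euclideanMetric n k (A t W : Mat n k)
          ((A' t Z : Mat n k) + fMap (ξ t) (A t Z : Mat n k)) = 0 := hA' t ht Z _ (A t W).2
      have h3 := (hξ t ht).euclideanMetric_fMap (A t Z : Mat n k) (A t W : Mat n k)
      rw [euclideanMetric_comm] at h2
      rw [map_add] at h1
      rw [map_add, LinearMap.add_apply] at h2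
      change euclideanMetric n k (A t Z : Mat n k) (A' t W : Mat n k) +
        euclideanMetric n k (A' t Z : Mat n k) (A t W : Mat n k) = 0
      linarith) ht h0
  rw [h, hA0]
  rfl

/-- The curve `A` in `End(F)` solves `A' = -P_F ∘ f_ξ ∘ A`, `A(0) = id`, where `P_F` is the
orthogonal projection onto `F`. Up to the action of a curve `q` with body velocity `ξ`, this is the
equation of parallel transport in the bundle with fibres `Φ_q F`. -/
structure IsProjectedTransport (I : Set ℝ) (F : Submodule ℝ (Mat n k))
    (ξ : ℝ → Mat n n × Mat k k) (A : ℝ → F →ₗ[ℝ] F) : Prop where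
  smooth : ∀ Z, ContDiffOn ℝ ∞ (fun t => A t Z) I
  ode : ∀ t ∈ I, ∀ Z, ((derivWithin (fun s => A s Z) I t : F) : Mat n k) +
    fMap (ξ t) (A t Z : Mat n k) ∈ (euclideanMetric n k).orthogonal F
  init : A 0 = LinearMap.id

namespace IsProjectedTransport

variable {I : Set ℝ} {F : Submodule ℝ (Mat n k)} {ξ : ℝ → Mat n n × Mat k k}
  {A : ℝ → F →ₗ[ℝ] F}

theorem differentiableOn (hA : IsProjectedTransport I F ξ A) (Z : F) :
    DifferentiableOn ℝ (fun t => A t Z) I :=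
  (hA.smooth Z).differentiableOn (by simp)

theorem preserves (hA : IsProjectedTransport I F ξ A) (hI : I.OrdConnected) (h0 : (0 : ℝ) ∈ I)
    (hξ : ∀ t ∈ I, IsSkewPair (ξ t)) {t : ℝ} (ht : t ∈ I) (Z W : F) :
    euclideanMetric n k (A t Z : Mat n k) (A t W : Mat n k) =
      euclideanMetric n k (Z : Mat n k) (W : Mat n k) :=
  euclideanMetric_preserved_of_transport hI h0 hξ hA.init
    (fun t ht Z => (hA.differentiableOn Z t ht).hasDerivWithinAt) hA.ode ht Z W

theorem bijective (hA : IsProjectedTransport I F ξ A) (hI : I.OrdConnected) (h0 : (0 : ℝ) ∈ I)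
    (hξ : ∀ t ∈ I, IsSkewPair (ξ t)) {t : ℝ} (ht : t ∈ I) : Function.Bijective (A t) := by
  have inj : Function.Injective (A t) := by
    refine (injective_iff_map_eq_zero _).2 fun Z hZ => ?_
    have := hA.preserves hI h0 hξ ht Z Z
    rw [hZ] at this
    ext1
    exact euclideanMetric_self_eq_zero (by rw [← this]; simp)
  exact ⟨inj, LinearMap.injective_iff_surjective.1 inj⟩

theorem isIsometryOnto (hA : IsProjectedTransport I F ξ A) (hI : I.OrdConnected)
    (h0 : (0 : ℝ) ∈ I) (hξ : ∀ t ∈ I, IsSkewPair (ξ t)) {t : ℝ} (ht : t ∈ I)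
    {q : Mat n n × Mat k k} (hq : IsOrthogonalPair q) :
    IsIsometryOnto F (F.map (stiefelAction q)) (stiefelAction q ∘ₗ F.subtype ∘ₗ A t) := by
  constructor
  · rw [LinearMap.range_comp, LinearMap.range_comp,
      LinearMap.range_eq_top.2 (hA.bijective hI h0 hξ ht).2, Submodule.map_top,
      Submodule.range_subtype]
  · intro V W
    exact (hq.euclideanMetric_stiefelAction _ _).trans (hA.preserves hI h0 hξ ht V W)

/-- The no-twist property: `Φ_q A` carries the constant sections with fibre `F`, and only these, to
parallel sections of the bundle with fibres `Φ_q F`. -/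
theorem isParallelAlong_iff {q : ℝ → Mat n n × Mat k k}
    (hA : IsProjectedTransport I F (bodyVelocity I q) A) (hI : I.OrdConnected) (hI' : I.Nontrivial)
    (h0 : (0 : ℝ) ∈ I) (hq : ContDiffOn ℝ ∞ q I) (hqo : ∀ t ∈ I, IsOrthogonalPair (q t))
    {G : Mat n k → Submodule ℝ (Mat n k)} {γ c : ℝ → Mat n k}
    (hG : ∀ t ∈ I, G (γ t) = F.map (stiefelAction (q t))) (Z : ℝ → F) :
    IsParallelAlong I G γ (fun t => stiefelAction (q t) (A t (Z t) : Mat n k)) ↔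
      IsParallelAlong I (fun _ => F) c (fun t => (Z t : Mat n k)) := by
  have hU := hI.uniqueDiffOn_real hI'
  have hqd : DifferentiableOn ℝ q I := hq.differentiableOn (by simp)
  have hξ : ∀ t ∈ I, IsSkewPair (bodyVelocity I q t) := fun t ht =>
    isSkewPair_bodyVelocity hU hqd hqo ht
  have hbij := fun t (ht : t ∈ I) => hA.bijective hI h0 hξ ht
  have hq1 : ContDiffOn ℝ ∞ (fun t => (q t).1) I := contDiff_fst.comp_contDiffOn hq
  have hq2 : ContDiffOn ℝ ∞ (fun t => (q t).2) I := contDiff_snd.comp_contDiffOn hq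
  have hsm : ContDiffOn ℝ ∞ (fun t => stiefelAction (q t) (A t (Z t) : Mat n k)) I ↔
      ContDiffOn ℝ ∞ (fun t => (Z t : Mat n k)) I := by
    rw [Submodule.contDiffOn_coe_iff, ← contDiffOn_linearMap_apply_iff hA.smooth hbij,
      ← Submodule.contDiffOn_coe_iff]
    refine ⟨fun h => ?_, fun h => (hq1.matrix_mul h).matrix_mul hq2.matrix_transpose⟩
    exact ((hq1.matrix_transpose.matrix_mul h).matrix_mul hq2).congr fun t ht =>
      ((hqo t ht).transpose_mul_stiefelAction _).symm
  have hproj : ContDiffOn ℝ ∞ (fun t => (Z t : Mat n k)) I → ∀ t ∈ I,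
      (derivWithin (fun t => stiefelAction (q t) (A t (Z t) : Mat n k)) I t ∈
          (euclideanMetric n k).orthogonal (G (γ t)) ↔
        derivWithin (fun t => (Z t : Mat n k)) I t ∈ (euclideanMetric n k).orthogonal F) := by
    intro hZ t ht
    obtain ⟨Z', hZ'⟩ : ∃ Z', HasDerivWithinAt Z Z' I t :=
      ⟨_, ((Submodule.contDiffOn_coe_iff.1 hZ).differentiableOn (by simp) t ht).hasDerivWithinAt⟩
    have eZ : derivWithin (fun t => (Z t : Mat n k)) I t = Z' :=
      hZ'.submodule_coe.derivWithin (hU t ht)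
    have hY : HasDerivWithinAt (fun t => (A t (Z t) : Mat n k))
        (((derivWithin (fun s => A s (Z t)) I t : F) : Mat n k) + (A t Z' : Mat n k)) I t :=
      (hasDerivWithinAt_linearMap_apply (hU t ht)
        (fun Z => hA.differentiableOn Z t ht) hZ').submodule_coe
    rw [eZ]
    have hqt := (hqd t ht).hasDerivWithinAt.congr_deriv
      (derivWithin_eq_mul_bodyVelocity (hqo t ht))
    have hW := (hqt.proj_fst.matrix_mul hY).matrix_mul hqt.proj_snd.matrix_transpose
    have hode := hA.ode t ht (Z t)
    have e : derivWithin (fun t => stiefelAction (q t) (A t (Z t) : Mat n k)) I t =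
        stiefelAction (q t) (((derivWithin (fun s => A s (Z t)) I t : F) : Mat n k) +
          fMap (bodyVelocity I q t) (A t (Z t) : Mat n k) + (A t Z' : Mat n k)) := by
      refine (hW.derivWithin (hU t ht)).trans ?_
      simp only [stiefelAction_apply, fMap, Matrix.transpose_mul, (hξ t ht).2,
        Matrix.mul_add, Matrix.add_mul, Matrix.mul_sub, Matrix.sub_mul, Matrix.mul_neg,
        Matrix.neg_mul, Matrix.mul_assoc]
      abel
    rw [e, hG t ht, (hqo t ht).mem_orthogonal_map, Submodule.add_mem_iff_right _ hode]
    constructor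
    · intro h
      have h1 : A t Z' = 0 := Subtype.ext (eq_zero_of_mem_of_mem_orthogonal (A t Z').2 h)
      have h2 : Z' = 0 := (hbij t ht).1 (h1.trans (map_zero _).symm)
      rw [h2]
      exact Submodule.zero_mem _
    · intro h
      have h1 : Z' = 0 := Subtype.ext (eq_zero_of_mem_of_mem_orthogonal Z'.2 h)
      rw [h1, map_zero]
      exact Submodule.zero_mem _
  constructor
  · rintro ⟨h1, -, h3⟩
    refine ⟨hsm.1 h1, fun t _ => (Z t).2, fun t ht => ⟨Submodule.zero_mem _, ?_⟩⟩
    rw [sub_zero, ← hproj (hsm.1 h1) t ht]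
    simpa using (h3 t ht).2
  · rintro ⟨h1, -, h3⟩
    refine ⟨hsm.2 h1, fun t ht => ?_, fun t ht => ⟨Submodule.zero_mem _, ?_⟩⟩
    · rw [hG t ht]
      exact Submodule.mem_map_of_mem (A t (Z t)).2
    · rw [sub_zero, hproj h1 t ht]
      simpa using (h3 t ht).2

end IsProjectedTransport

end Transport

/-! ### The infinitesimal geometry of the Stiefel manifold -/

section Infinitesimal

variable {n k : ℕ} {X : Mat n k}

theorem infAction_lie (X : Mat n k) (ξ ζ : SoPair n k) :
    infAction X ⁅ξ, ζ⁆ = fMap (soInclusion n k ξ) (infAction X ζ) -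
      fMap (soInclusion n k ζ) (infAction X ξ) := by
  have h1 : ((⁅ξ, ζ⁆ : SoPair n k).1 : Mat n n) =
      (ξ.1 : Mat n n) * (ζ.1 : Mat n n) - (ζ.1 : Mat n n) * (ξ.1 : Mat n n) := rfl
  have h2 : ((⁅ξ, ζ⁆ : SoPair n k).2 : Mat k k) =
      (ξ.2 : Mat k k) * (ζ.2 : Mat k k) - (ζ.2 : Mat k k) * (ξ.2 : Mat k k) := rfl
  simp only [infAction_apply, fMap, h1, h2, soInclusion, LinearMap.coe_mk, AddHom.coe_mk,
    Matrix.mul_sub, Matrix.sub_mul, Matrix.mul_assoc]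
  abel

/-- The symmetric part of `(V, W) ↦ f_ξ W`, where `ξ ∈ 𝔭` represents `V`, is normal. -/
theorem fMap_add_fMap (V W : tangentSpaceSt X) :
    fMap (soInclusion n k (tangentToSo X V)) (W : Mat n k) +
      fMap (soInclusion n k (tangentToSo X W)) (V : Mat n k) =
      -(X * ((V : Mat n k)ᵀ * (W : Mat n k) + (W : Mat n k)ᵀ * (V : Mat n k))) := by
  simp only [fMap, soInclusion, tangentToSo, LinearMap.coe_mk, AddHom.coe_mk, Matrix.sub_mul,
    Matrix.mul_add, Matrix.mul_assoc]
  abel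

theorem infAction_projHorizontal (hX : X ∈ stiefel n k) (ξ : SoPair n k) :
    infAction X (projHorizontal hX ξ : SoPair n k) = infAction X ξ := by
  have h : ξ - (projHorizontal hX ξ : SoPair n k) ∈ stabAlgebra X := by
    rw [← Submodule.projectionOnto_apply_eq_zero_iff (isCompl_horizontal_stab hX), map_sub,
      Submodule.projectionOnto_apply_left]
    exact sub_self _
  have h' : infAction X (ξ - (projHorizontal hX ξ : SoPair n k)) = 0 := h
  rw [map_sub, sub_eq_zero] at h'
  exact h'.symm

/-- The bilinear map `(V, W) ↦ ½ λ(pr_𝔭 [λ⁻¹ V, λ⁻¹ W])` on the tangent space, `λ` being the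
isomorphism from `𝔭`. -/
noncomputable def halfBracket (hX : X ∈ stiefel n k) :
    tangentSpaceSt X →ₗ[ℝ] tangentSpaceSt X →ₗ[ℝ] tangentSpaceSt X :=
  LinearMap.mk₂ ℝ
    (fun V W => horizontalEquiv hX ((1 / 2 : ℝ) • projHorizontal hX
      ⁅((horizontalEquiv hX).symm V : SoPair n k), ((horizontalEquiv hX).symm W : SoPair n k)⁆))
    (fun V V' W => by simp only [map_add, Submodule.coe_add, add_lie, smul_add])
    (fun c V W => by simp only [map_smul, Submodule.coe_smul, smul_lie, smul_comm c])
    (fun V W W' => by simp only [map_add, Submodule.coe_add, lie_add, smul_add])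
    (fun c V W => by simp only [map_smul, Submodule.coe_smul, lie_smul, smul_comm c])

theorem halfBracket_apply (hX : X ∈ stiefel n k) (V W : tangentSpaceSt X) :
    halfBracket hX V W = horizontalEquiv hX ((1 / 2 : ℝ) • projHorizontal hX
      ⁅((horizontalEquiv hX).symm V : SoPair n k), ((horizontalEquiv hX).symm W : SoPair n k)⁆) :=
  rfl

/-- The body velocity `λ⁻¹ V ∈ 𝔭` of a tangent vector `V`, as a pair of matrices. -/
noncomputable def bodyMap (hX : X ∈ stiefel n k) : tangentSpaceSt X →ₗ[ℝ] Mat n n × Mat k k :=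
  soInclusion n k ∘ₗ (horizontalAlgebra X).subtype ∘ₗ (horizontalEquiv hX).symm.toLinearMap

theorem bodyMap_apply (hX : X ∈ stiefel n k) (V : tangentSpaceSt X) :
    bodyMap hX V = soInclusion n k (tangentToSo X V) := rfl

theorem isSkewPair_bodyMap (hX : X ∈ stiefel n k) (V : tangentSpaceSt X) :
    IsSkewPair (bodyMap hX V) := isSkewPair_soInclusion _

/-- `½ [λ⁻¹ V, λ⁻¹ W]` represents the tangential part of `f_ξ W` for `ξ = λ⁻¹ V`. This is the
Levi-Civita connection of the normal homogeneous space `St(n,k)` at `X`. -/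
theorem fMap_bodyMap_sub_halfBracket_mem (hX : X ∈ stiefel n k) (V W : tangentSpaceSt X) :
    fMap (bodyMap hX V) (W : Mat n k) - (halfBracket hX V W : Mat n k) ∈
      (euclideanMetric n k).orthogonal (tangentSpaceSt X) := by
  have h1 : (halfBracket hX V W : Mat n k) = (1 / 2 : ℝ) •
      (fMap (bodyMap hX V) (W : Mat n k) - fMap (bodyMap hX W) (V : Mat n k)) := by
    have e : (halfBracket hX V W : Mat n k) = infAction X ((1 / 2 : ℝ) •
        (projHorizontal hX ⁅tangentToSo X V, tangentToSo X W⁆ : SoPair n k)) := rfl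
    rw [e, map_smul, infAction_projHorizontal, infAction_lie, infAction_tangentToSo hX,
      infAction_tangentToSo hX]
    rfl
  have h2 := fMap_add_fMap V W
  rw [← bodyMap_apply hX, ← bodyMap_apply hX] at h2
  have h3 : fMap (bodyMap hX V) (W : Mat n k) - (halfBracket hX V W : Mat n k) =
      (1 / 2 : ℝ) • (fMap (bodyMap hX V) (W : Mat n k) + fMap (bodyMap hX W) (V : Mat n k)) := by
    rw [h1]
    module
  rw [h3, h2, ← Matrix.mul_neg]
  refine Submodule.smul_mem _ _ (mul_mem_normalSpaceSt X ?_)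
  simp only [Matrix.transpose_neg, Matrix.transpose_add, Matrix.transpose_mul,
    Matrix.transpose_transpose]
  rw [add_comm]

theorem sub_normalProj_mem_orthogonal (hX : X ∈ stiefel n k) (V : Mat n k) :
    V - (normalProj X V : Mat n k) ∈ (euclideanMetric n k).orthogonal (normalSpaceSt X) := by
  rw [orthogonal_normalSpaceSt]
  exact sub_normalProj_mem hX V

/-- The maps `λ⁻¹` and `(Ω, η) ↦ Ω X - X η` are adjoint to each other. -/
theorem alphaForm_tangentToSo (ζ : SoPair n k) (V : tangentSpaceSt X) :
    alphaForm n k (-1 / 2) ζ (tangentToSo X V) =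
      euclideanMetric n k (infAction X ζ) (V : Mat n k) := by
  obtain ⟨V, hV⟩ := V
  have e1 : ((ζ.1 : Mat n n) * (V * Xᵀ)).trace = (Xᵀ * ((ζ.1 : Mat n n) * V)).trace := by
    rw [← Matrix.mul_assoc, Matrix.trace_mul_comm]
  have e2 : ((ζ.1 : Mat n n) * (X * Vᵀ)).trace = -(Xᵀ * ((ζ.1 : Mat n n) * V)).trace := by
    rw [← Matrix.trace_transpose]
    simp only [Matrix.transpose_mul, Matrix.transpose_transpose, so_transpose]
    rw [Matrix.mul_neg, Matrix.trace_neg, Matrix.mul_assoc, Matrix.trace_mul_comm,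
      Matrix.mul_assoc]
  rw [alphaForm_apply, euclideanMetric_apply, infAction_apply]
  simp only [tangentToSo, Matrix.transpose_sub, Matrix.transpose_mul, so_transpose, Matrix.mul_sub,
    Matrix.sub_mul, Matrix.trace_sub, Matrix.mul_neg, Matrix.neg_mul, Matrix.trace_neg, e1, e2,
    Matrix.mul_assoc]
  ring

/-- On `𝔭`, the scalar product is the pull-back of the Euclidean metric under `λ`. -/
theorem alphaForm_horizontal (hX : X ∈ stiefel n k) (Z W : horizontalAlgebra X) :
    alphaForm n k (-1 / 2) (Z : SoPair n k) (W : SoPair n k) =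
      euclideanMetric n k (horizontalEquiv hX Z : Mat n k) (horizontalEquiv hX W : Mat n k) := by
  have h := alphaForm_tangentToSo (Z : SoPair n k) (horizontalEquiv hX W)
  have e : tangentToSo X (horizontalEquiv hX W) = W :=
    congrArg Subtype.val ((horizontalEquiv hX).symm_apply_apply W)
  rw [e] at h
  exact h

theorem orbitDifferential_leftTranslate (X : Mat n k) (q : Mat n n × Mat k k) (ξ : SoPair n k) :
    orbitDifferential X q (leftTranslate q ξ) = stiefelAction q (infAction X ξ) := by
  simp only [orbitDifferential, leftTranslate, stiefelAction_apply, infAction_apply,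
    LinearMap.coe_mk, AddHom.coe_mk, Matrix.transpose_mul, so_transpose, Matrix.mul_sub,
    Matrix.sub_mul, Matrix.neg_mul, Matrix.mul_neg, Matrix.mul_assoc]
  abel

end Infinitesimal

/-! ### Solutions of the kinematic equations are extrinsic rollings -/

section Rolling

variable {n k : ℕ} {X : Mat n k} {hX : X ∈ stiefel n k} {I : Set ℝ} {β : ℝ → tangentSpaceSt X}
  {S : ℝ → horizontalAlgebra X →ₗ[ℝ] horizontalAlgebra X} {q : ℝ → Mat n n × Mat k k}
  {T : ℝ → normalSpaceSt X →ₗ[ℝ] normalSpaceSt X}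

namespace IsIntrinsicKinematicSolution

theorem hasDerivWithinAt_conj (h : IsIntrinsicKinematicSolution hX I β S q) {t : ℝ} (ht : t ∈ I)
    (V : tangentSpaceSt X) :
    HasDerivWithinAt (fun s => (horizontalEquiv hX).conj (S s) V)
      (-halfBracket hX ((horizontalEquiv hX).conj (S t) (derivWithin β I t))
        ((horizontalEquiv hX).conj (S t) V)) I t := by
  have h1 : HasDerivWithinAt
      (fun s => soInclusion n k (S s ((horizontalEquiv hX).symm V) : SoPair n k)) _ I t :=
    ((h.smooth_S ((horizontalEquiv hX).symm V)).differentiableOn (by simp) t ht).hasDerivWithinAt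
  have h2 := ((fMapL n k).flip X).hasFDerivAt.comp_hasDerivWithinAt t
    (h1.congr_deriv (h.ode_S t ht _))
  rw [← hasDerivWithinAt_submodule_coe_iff]
  refine h2.congr_deriv ?_
  have e : -halfBracket hX ((horizontalEquiv hX).conj (S t) (derivWithin β I t))
      ((horizontalEquiv hX).conj (S t) V) = horizontalEquiv hX (-(1 / 2 : ℝ) • projHorizontal hX
        ⁅(S t (controlCurve hX I β t) : SoPair n k),
          (S t ((horizontalEquiv hX).symm V) : SoPair n k)⁆) := by
    rw [halfBracket_apply, LinearEquiv.conj_apply_apply, LinearEquiv.conj_apply_apply,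
      LinearEquiv.symm_apply_apply, LinearEquiv.symm_apply_apply, ← map_neg]
    exact congrArg _ (neg_smul _ _).symm
  rw [e]
  rfl

theorem contDiffOn_conj (h : IsIntrinsicKinematicSolution hX I β S q) (V : tangentSpaceSt X) :
    ContDiffOn ℝ ∞ (fun s => (horizontalEquiv hX).conj (S s) V) I := by
  rw [← Submodule.contDiffOn_coe_iff]
  exact ((fMapL n k).flip X).contDiff.comp_contDiffOn
    (h.smooth_S ((horizontalEquiv hX).symm V))

theorem ode_q_bodyMap (h : IsIntrinsicKinematicSolution hX I β S q) {t : ℝ} (ht : t ∈ I) :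
    derivWithin q I t =
      ((q t).1 * (bodyMap hX ((horizontalEquiv hX).conj (S t) (derivWithin β I t))).1,
        (q t).2 * (bodyMap hX ((horizontalEquiv hX).conj (S t) (derivWithin β I t))).2) := by
  rw [h.ode_q t ht, LinearEquiv.conj_apply_apply]
  have e : bodyMap hX (horizontalEquiv hX (S t ((horizontalEquiv hX).symm (derivWithin β I t)))) =
      soInclusion n k (S t (controlCurve hX I β t) : SoPair n k) := by
    simp only [bodyMap, LinearMap.comp_apply, LinearEquiv.coe_coe, LinearEquiv.symm_apply_apply]
    rfl
  rw [e]
  rfl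

theorem hasDerivWithinAt_q (h : IsIntrinsicKinematicSolution hX I β S q) {t : ℝ} (ht : t ∈ I) :
    HasDerivWithinAt q
      ((q t).1 * (bodyMap hX ((horizontalEquiv hX).conj (S t) (derivWithin β I t))).1,
        (q t).2 * (bodyMap hX ((horizontalEquiv hX).conj (S t) (derivWithin β I t))).2) I t :=
  (h.smooth_q.differentiableOn (by simp) t ht).hasDerivWithinAt.congr_deriv (h.ode_q_bodyMap ht)

theorem isOrthogonalPair (h : IsIntrinsicKinematicSolution hX I β S q) (hI : I.OrdConnected)
    (h0 : (0 : ℝ) ∈ I) : ∀ t ∈ I, IsOrthogonalPair (q t) :=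
  isOrthogonalPair_of_hasDerivWithinAt hI h0 h.init_q (fun _ _ => isSkewPair_bodyMap hX _)
    fun _ ht => h.hasDerivWithinAt_q ht

theorem bodyVelocity_eq (h : IsIntrinsicKinematicSolution hX I β S q) (hI : I.OrdConnected)
    (h0 : (0 : ℝ) ∈ I) {t : ℝ} (ht : t ∈ I) : bodyVelocity I q t =
      bodyMap hX ((horizontalEquiv hX).conj (S t) (derivWithin β I t)) :=
  _root_.bodyVelocity_eq (h.isOrthogonalPair hI h0 t ht) (h.ode_q_bodyMap ht)

/-- In terms of the tangent space, the equation for `S` is the equation of projected transport. -/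
theorem isProjectedTransport (h : IsIntrinsicKinematicSolution hX I β S q) (hI : I.OrdConnected)
    (hI' : I.Nontrivial) (h0 : (0 : ℝ) ∈ I) :
    IsProjectedTransport I (tangentSpaceSt X) (bodyVelocity I q)
      (fun t => (horizontalEquiv hX).conj (S t)) where
  smooth := h.contDiffOn_conj
  ode t ht V := by
    have e : derivWithin (fun s => (horizontalEquiv hX).conj (S s) V) I t = _ :=
      (h.hasDerivWithinAt_conj ht V).derivWithin (hI.uniqueDiffOn_real hI' t ht)
    rw [e, h.bodyVelocity_eq hI h0 ht, Submodule.coe_neg, neg_add_eq_sub]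
    exact fMap_bodyMap_sub_halfBracket_mem hX _ _
  init := by rw [h.init_S]; exact LinearEquiv.conj_id _

theorem isOrthogonalOnHorizontal (h : IsIntrinsicKinematicSolution hX I β S q)
    (hI : I.OrdConnected) (hI' : I.Nontrivial) (h0 : (0 : ℝ) ∈ I) {t : ℝ} (ht : t ∈ I) :
    IsOrthogonalOnHorizontal (S t) := by
  have hA := h.isProjectedTransport hI hI' h0
  have hξ : ∀ t ∈ I, IsSkewPair (bodyVelocity I q t) := fun t ht => by
    rw [h.bodyVelocity_eq hI h0 ht]
    exact isSkewPair_bodyMap hX _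
  have hS : ∀ Z, S t Z =
      (horizontalEquiv hX).symm ((horizontalEquiv hX).conj (S t) (horizontalEquiv hX Z)) := by
    intro Z
    simp [LinearEquiv.conj_apply_apply]
  constructor
  · have hb := hA.bijective hI h0 hξ ht
    have : (S t : horizontalAlgebra X → horizontalAlgebra X) = (horizontalEquiv hX).symm ∘
        (horizontalEquiv hX).conj (S t) ∘ horizontalEquiv hX := funext hS
    rw [this]
    exact (horizontalEquiv hX).symm.bijective.comp (hb.comp (horizontalEquiv hX).bijective)
  · intro Z W
    have e := hA.preserves hI h0 hξ ht (horizontalEquiv hX Z) (horizontalEquiv hX W)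
    rw [alphaForm_horizontal hX, alphaForm_horizontal hX, ← e]
    simp [LinearEquiv.conj_apply_apply]

end IsIntrinsicKinematicSolution

theorem IsNormalKinematicSolution.isProjectedTransport (hX : X ∈ stiefel n k)
    (h : IsNormalKinematicSolution X I q T) :
    IsProjectedTransport I (normalSpaceSt X) (bodyVelocity I q) T where
  smooth := h.smooth_T
  ode t ht Z := by
    rw [h.ode_T t ht Z, Submodule.coe_neg, neg_add_eq_sub]
    exact sub_normalProj_mem_orthogonal hX _
  init := h.init_T

theorem tangentRolling_eq (S : ℝ → horizontalAlgebra X →ₗ[ℝ] horizontalAlgebra X)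
    (q : ℝ → Mat n n × Mat k k) (t : ℝ) :
    tangentRolling hX S q t = stiefelAction (q t) ∘ₗ (tangentSpaceSt X).subtype ∘ₗ
      (horizontalEquiv hX).conj (S t) :=
  LinearMap.ext fun _ => orbitDifferential_leftTranslate X (q t) _

theorem contDiffOn_development (hq : ContDiffOn ℝ ∞ q I) :
    ContDiffOn ℝ ∞ (development X q) I :=
  ((contDiff_fst.comp_contDiffOn hq).matrix_mul contDiffOn_const).matrix_mul
    (contDiff_snd.comp_contDiffOn hq).matrix_transpose

/-- The normal part of the rolling may be formed with any smooth orthogonal lift `q` of the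
development curve, horizontal or not: the equation for `T` is stated in the frame given by `q`, and
the component of the body velocity of `q` in the stabilizer algebra enters it as well. -/
theorem isExtrinsicRolling_of_lift {r : ℝ → Mat n n × Mat k k} (hI : I.OrdConnected)
    (hI' : I.Nontrivial) (h0 : (0 : ℝ) ∈ I) (hβ : ContDiffOn ℝ ∞ β I)
    (h : IsIntrinsicKinematicSolution hX I β S r) (hq : ContDiffOn ℝ ∞ q I)
    (hqo : ∀ t ∈ I, IsOrthogonalPair (q t))
    (hqr : ∀ t ∈ I, stiefelAction (q t) X = development X r t)
    (hT : IsNormalKinematicSolution X I q T) :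
    (∀ t ∈ I, IsOrthogonalOnNormal (T t)) ∧
      IsExtrinsicRolling X I β (development X r) (tangentRolling hX S r) (normalRolling q T) := by
  have hU := hI.uniqueDiffOn_real hI'
  have hro := h.isOrthogonalPair hI h0
  have hA := h.isProjectedTransport hI hI' h0
  have hN := hT.isProjectedTransport hX
  have hξr : ∀ t ∈ I, IsSkewPair (bodyVelocity I r t) := fun t ht =>
    isSkewPair_bodyVelocity hU (h.smooth_q.differentiableOn (by simp)) hro ht
  have hξq : ∀ t ∈ I, IsSkewPair (bodyVelocity I q t) := fun t ht =>
    isSkewPair_bodyVelocity hU (hq.differentiableOn (by simp)) hqo ht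
  have hGr : ∀ t ∈ I, tangentSpaceSt (development X r t) =
      (tangentSpaceSt X).map (stiefelAction (r t)) := fun t ht =>
    ((hro t ht).map_tangentSpaceSt X).symm
  have hGq : ∀ t ∈ I, normalSpaceSt (development X r t) =
      (normalSpaceSt X).map (stiefelAction (q t)) := fun t ht => by
    rw [← hqr t ht, (hqo t ht).map_normalSpaceSt]
  refine ⟨fun t ht => ⟨hN.bijective hI h0 hξq ht, fun Z W => hN.preserves hI h0 hξq ht Z W⟩, ?_⟩
  refine ⟨hβ, contDiffOn_development h.smooth_q, fun t ht => (hro t ht).stiefelAction_mem_stiefel hX,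
    fun t ht => ?_, fun t ht => ?_, fun t ht => ?_, fun Z => ?_, fun Z => ?_⟩
  · rw [hGr t ht, tangentRolling_eq]
    exact hA.isIsometryOnto hI h0 hξr ht (hro t ht)
  · rw [hGq t ht]
    exact hN.isIsometryOnto hI h0 hξq ht (hqo t ht)
  · have hr := (h.smooth_q.differentiableOn (by simp) t ht).hasDerivWithinAt.congr_deriv
      (h.ode_q t ht)
    exact ((hasFDerivAt_orbit X (r t)).comp_hasDerivWithinAt t hr).derivWithin (hU t ht)
  · simp only [tangentRolling_eq]
    exact hA.isParallelAlong_iff hI hI' h0 h.smooth_q hro hGr Z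
  · exact hN.isParallelAlong_iff hI hI' h0 hq hqo hGq Z

end Rolling

/-! ### Existence and uniqueness of solutions of the kinematic equations -/

section Existence

variable {n k : ℕ} {X : Mat n k} {hX : X ∈ stiefel n k} {I : Set ℝ} {β : ℝ → tangentSpaceSt X}

/-- The bilinear map `(V, q) ↦ (dL_q)(λ⁻¹ V)`. -/
noncomputable def leftTranslateMap (hX : X ∈ stiefel n k) :
    tangentSpaceSt X →ₗ[ℝ] (Mat n n × Mat k k) →ₗ[ℝ] Mat n n × Mat k k :=
  LinearMap.mk₂ ℝ (fun V q => (q.1 * (bodyMap hX V).1, q.2 * (bodyMap hX V).2))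
    (fun V V' q => by simp [Matrix.mul_add]) (fun c V q => by simp)
    (fun V q q' => by simp [Matrix.add_mul]) (fun c V q => by simp)

/-- The bilinear map `(V, W) ↦ P_X^⊥ (f_ξ W)` with `ξ = λ⁻¹ V`. -/
noncomputable def normalConnection (hX : X ∈ stiefel n k) :
    tangentSpaceSt X →ₗ[ℝ] normalSpaceSt X →ₗ[ℝ] normalSpaceSt X :=
  LinearMap.mk₂ ℝ (fun V W => normalProj X (fMapL n k (bodyMap hX V) (W : Mat n k)))
    (fun V V' W => by simp only [map_add, add_apply])
    (fun c V W => by simp only [map_smul, smul_apply])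
    (fun V W W' => by simp only [map_add, Submodule.coe_add])
    (fun c V W => by simp only [map_smul, Submodule.coe_smul])

theorem normalConnection_apply (hX : X ∈ stiefel n k) (V : tangentSpaceSt X)
    (W : normalSpaceSt X) :
    normalConnection hX V W = normalProj X (fMap (bodyMap hX V) (W : Mat n k)) := rfl

/-- The kinematic equations as a transport system on `End(T_X) × (ℝⁿˣⁿ × ℝᵏˣᵏ) × End(N_X)`. -/
abbrev IsKinematicTransport (hX : X ∈ stiefel n k) (J : Set ℝ) (c : ℝ → ℝ)
    (v : ℝ → tangentSpaceSt X) (A : ℝ → tangentSpaceSt X →ₗ[ℝ] tangentSpaceSt X)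
    (q : ℝ → Mat n n × Mat k k) (T : ℝ → normalSpaceSt X →ₗ[ℝ] normalSpaceSt X) : Prop :=
  IsTransportSolution (halfBracket hX) (leftTranslateMap hX) (normalConnection hX) (1, 1) J c v A q T

theorem IsKinematicTransport.norm_le {J : Set ℝ} (hJ : J.OrdConnected) (h0 : (0 : ℝ) ∈ J)
    {c : ℝ → ℝ} {v : ℝ → tangentSpaceSt X} {A : ℝ → tangentSpaceSt X →ₗ[ℝ] tangentSpaceSt X}
    {q : ℝ → Mat n n × Mat k k} {T : ℝ → normalSpaceSt X →ₗ[ℝ] normalSpaceSt X}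
    (h : IsKinematicTransport hX J c v A q T) {t : ℝ} (ht : t ∈ J) :
    (∀ Z, ‖A t Z‖ ≤ max 1 √(2 * (k * n)) * ‖Z‖) ∧ ‖q t‖ ≤ max 1 √(2 * (k * n)) ∧
      ∀ Z, ‖T t Z‖ ≤ max 1 √(2 * (k * n)) * ‖Z‖ := by
  have hξ : ∀ t ∈ J, IsSkewPair (c t • bodyMap hX (A t (v t))) := fun t _ =>
    (isSkewPair_bodyMap hX _).smul _
  have hA := euclideanMetric_preserved_of_transport hJ h0 hξ h.init_A h.deriv_A
    (fun t ht Z => by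
      rw [fMap_smul, Submodule.coe_neg, Submodule.coe_smul, neg_add_eq_sub, ← smul_sub]
      exact Submodule.smul_mem _ _ (fMap_bodyMap_sub_halfBracket_mem hX _ _)) ht
  have hT := euclideanMetric_preserved_of_transport hJ h0 hξ h.init_T h.deriv_T
    (fun t ht Z => by
      rw [fMap_smul, Submodule.coe_neg, Submodule.coe_smul, neg_add_eq_sub, ← smul_sub]
      exact Submodule.smul_mem _ _ (sub_normalProj_mem_orthogonal hX _)) ht
  have hq := isOrthogonalPair_of_hasDerivWithinAt hJ h0 h.init_q hξ
    (fun t ht => (h.deriv_q t ht).congr_deriv (by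
      ext1 <;> simp [leftTranslateMap])) t ht
  refine ⟨fun Z => ?_, ?_, fun Z => ?_⟩
  · refine (norm_le_of_euclideanMetric_self_eq (hA Z Z)).trans ?_
    exact mul_le_mul_of_nonneg_right (le_max_right _ _) (norm_nonneg _)
  · refine le_trans (max_le ?_ ?_) (le_max_left _ _)
    · exact entrywise_sup_norm_bound_of_unitary hq.1
    · exact entrywise_sup_norm_bound_of_unitary hq.2
  · refine (norm_le_of_euclideanMetric_self_eq (hT Z Z)).trans ?_
    exact mul_le_mul_of_nonneg_right (le_max_right _ _) (norm_nonneg _)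

theorem IsExtrinsicKinematicSolution.isKinematicTransport (hI : I.OrdConnected)
    (h0 : (0 : ℝ) ∈ I) {S : ℝ → horizontalAlgebra X →ₗ[ℝ] horizontalAlgebra X}
    {q : ℝ → Mat n n × Mat k k} {T : ℝ → normalSpaceSt X →ₗ[ℝ] normalSpaceSt X}
    (h : IsExtrinsicKinematicSolution hX I β S q T) :
    IsKinematicTransport hX I 1 (derivWithin β I) (fun t => (horizontalEquiv hX).conj (S t)) q T where
  init_A := by rw [h.1.init_S]; exact LinearEquiv.conj_id _
  init_q := h.1.init_q
  init_T := h.2.init_T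
  deriv_A t ht Z := (h.1.hasDerivWithinAt_conj ht Z).congr_deriv
    (by rw [Pi.one_apply, one_smul])
  deriv_q t ht := (h.1.hasDerivWithinAt_q ht).congr_deriv (by rw [Pi.one_apply, one_smul]; rfl)
  deriv_T t ht Z :=
    ((h.2.smooth_T Z).differentiableOn (by simp) t ht).hasDerivWithinAt.congr_deriv (by
      rw [Pi.one_apply, one_smul, normalConnection_apply, ← h.1.bodyVelocity_eq hI h0 ht]
      exact h.2.ode_T t ht Z)

theorem IsKinematicTransport.isExtrinsicKinematicSolution (hI : I.OrdConnected)
    (hI' : I.Nontrivial) (h0 : (0 : ℝ) ∈ I)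
    {A : ℝ → tangentSpaceSt X →ₗ[ℝ] tangentSpaceSt X} {q : ℝ → Mat n n × Mat k k}
    {T : ℝ → normalSpaceSt X →ₗ[ℝ] normalSpaceSt X}
    (h : IsKinematicTransport hX I 1 (derivWithin β I) A q T)
    (hA : ∀ Z, ContDiffOn ℝ ∞ (fun t => A t Z) I) (hq : ContDiffOn ℝ ∞ q I)
    (hT : ∀ Z, ContDiffOn ℝ ∞ (fun t => T t Z) I) :
    IsExtrinsicKinematicSolution hX I β (fun t => (horizontalEquiv hX).symm.conj (A t)) q T := by
  have hU := hI.uniqueDiffOn_real hI'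
  let L := LinearMap.toContinuousLinearMap (bodyMap hX)
  have eu : ∀ t, (horizontalEquiv hX).symm.conj (A t) (controlCurve hX I β t) =
      (horizontalEquiv hX).symm (A t (derivWithin β I t)) := fun t => by
    simp [controlCurve, LinearEquiv.conj_apply_apply]
  have hintr : IsIntrinsicKinematicSolution hX I β
      (fun t => (horizontalEquiv hX).symm.conj (A t)) q := by
    refine ⟨fun Z => ?_, hq, fun t ht Z => ?_, fun t ht => ?_, ?_, h.init_q⟩
    · exact L.contDiff.comp_contDiffOn (hA (horizontalEquiv hX Z))
    · have h1 := (L.hasFDerivAt.comp_hasDerivWithinAt t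
        (h.deriv_A t ht (horizontalEquiv hX Z))).derivWithin (hU t ht)
      have e : (horizontalEquiv hX).symm (-((1 : ℝ → ℝ) t • halfBracket hX
          (A t (derivWithin β I t)) (A t (horizontalEquiv hX Z)))) =
          -(1 / 2 : ℝ) • projHorizontal hX
            ⁅((horizontalEquiv hX).symm (A t (derivWithin β I t)) : SoPair n k),
              ((horizontalEquiv hX).symm (A t (horizontalEquiv hX Z)) : SoPair n k)⁆ := by
        rw [Pi.one_apply, one_smul, halfBracket_apply, ← map_neg, LinearEquiv.symm_apply_apply]
        exact (neg_smul _ _).symm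
      rw [eu]
      exact h1.trans (congrArg (fun ζ : horizontalAlgebra X => soInclusion n k (ζ : SoPair n k)) e)
    · rw [eu]
      refine ((h.deriv_q t ht).derivWithin (hU t ht)).trans ?_
      rw [Pi.one_apply, one_smul]
      rfl
    · rw [h.init_A]
      exact LinearEquiv.conj_id _
  refine ⟨hintr, hT, fun t ht Z => ?_, h.init_T⟩
  rw [hintr.bodyVelocity_eq hI h0 ht]
  refine ((h.deriv_T t ht Z).derivWithin (hU t ht)).trans ?_
  have e : (horizontalEquiv hX).conj ((horizontalEquiv hX).symm.conj (A t)) = A t := by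
    ext V
    simp
  simp only [Pi.one_apply, one_smul, e]
  rfl

end Existence

theorem mainTheorem4 {n k : ℕ} (X : Mat n k) (hX : X ∈ stiefel n k)
    (I : Set ℝ) (hI : I.OrdConnected) (hI' : I.Nontrivial) (h0 : (0 : ℝ) ∈ I)
    (β : ℝ → tangentSpaceSt X) (hβ : ContDiffOn ℝ ∞ β I) :
    -- the system of kinematic equations has a unique solution on `I`
    (∃ S q T, IsExtrinsicKinematicSolution hX I β S q T ∧
      ∀ S' q' T', IsExtrinsicKinematicSolution hX I β S' q' T' →
        Set.EqOn S' S I ∧ Set.EqOn q' q I ∧ Set.EqOn T' T I) ∧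
    -- the extrinsic rolling that extends the intrinsic one, for the horizontal lift `q` through
    -- the identity of the development curve
    (∀ S r, IsIntrinsicKinematicSolution hX I β S r →
      ∀ q T, IsHorizontalLift X I (development X r) q → q 0 = (1, 1) →
        IsNormalKinematicSolution X I q T →
        (∀ t ∈ I, IsOrthogonalOnNormal (T t)) ∧
        IsExtrinsicRolling X I β (development X r) (tangentRolling hX S r) (normalRolling q T)) ∧
    -- the extrinsic rolling in terms of the kinematic equations alone
    (∀ S q T, IsExtrinsicKinematicSolution hX I β S q T →
      (∀ t ∈ I, IsOrthogonalOnHorizontal (S t) ∧ IsOrthogonalPair (q t) ∧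
        IsOrthogonalOnNormal (T t)) ∧
      IsExtrinsicRolling X I β (development X q) (tangentRolling hX S q) (normalRolling q T)) := by
  refine ⟨?_, fun S r h q T hq _ hT => ?_, fun S q T h => ?_⟩
  · have hv : ContDiffOn ℝ ∞ (derivWithin β I) I :=
      ((contDiffOn_infty_iff_derivWithin (hI.uniqueDiffOn_real hI')).1 hβ).2
    obtain ⟨A, q, T, h, hA, hq, hT⟩ := exists_isTransportSolution
      (D₁ := halfBracket hX) (m := leftTranslateMap hX) (D₂ := normalConnection hX) (q₀ := (1, 1))
      hI hI' h0 hv (ρ := max 1 √(2 * (k * n))) (by positivity)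
      fun J _ hJ hJ0 c A q T h t ht => IsKinematicTransport.norm_le hJ hJ0 h ht
    have hsol := IsKinematicTransport.isExtrinsicKinematicSolution hI hI' h0 h hA hq hT
    refine ⟨_, q, T, hsol, fun S' q' T' h' => ?_⟩
    obtain ⟨eA, eq, eT⟩ := (h'.isKinematicTransport hI h0).eqOn hI h0 hv.continuousOn
      (hsol.isKinematicTransport hI h0)
    exact ⟨fun t ht => (horizontalEquiv hX).conj.injective (eA ht), eq, eT⟩
  · exact isExtrinsicRolling_of_lift hI hI' h0 hβ h hq.smooth hq.orthogonal hq.lifts hT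
  · have hqo := h.1.isOrthogonalPair hI h0
    have hroll := isExtrinsicRolling_of_lift hI hI' h0 hβ h.1 h.1.smooth_q hqo
      (fun _ _ => rfl) h.2
    exact ⟨fun t ht => ⟨h.1.isOrthogonalOnHorizontal hI hI' h0 ht, hqo t ht, hroll.1 t ht⟩,
      hroll.2⟩
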